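/- **Proposition.** Let $d\ge 0$, let $A\in GL_d(\mathbb Q)$, and let $H\subset\mathbb Q^d$ be an additive subgroup with $A(H)=H$ whose $\mathbb Q$-linear span has dimension $d$. Let $G=\mathbb Z\ltimes_A H$ be the semidirect product in which conjugation by the generator of $\mathbb Z$ acts on $H$ as $A$. Let $\varphi$ be a faithful action of $G$ on $[0,1]$ by orientation-preserving $C^1$ diffeomorphisms. Then $\varphi$ can be approximated in the $C^1$ topology by actions by $C^1$ diffeomorphisms that are topologically conjugate to $\varphi$ but not Lipschitz conjugate to it. Precisely: for every finite set $F\subset G$ and every $\varepsilon>0$ there is an action $\psi$ of $G$ on $[0,1]$ by orientation-preserving $C^1$ diffeomorphisms such that 1. for every $g\in F$ and every $x\in[0,1]$, $|\varphi(g)(x)-\psi(g)(x)|<\varepsilon$ and $|\varphi(g)'(x)-\psi(g)'(x)|<\varepsilon$; 2. there is an orientation-preserving homeomorphism $h$ of $[0,1]$ with $h\circ\varphi(g)=\psi(g)\circ h$ for all $g\in G$; 3. no homeomorphism $h$ of $[0,1]$ (orientation-preserving or not) satisfying $h\circ\varphi(g)=\psi(g)\circ h$ for all $g\in G$ is Lipschitz,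 and the inverse of no such $h$ is Lipschitz. -/

import Mathlib

open Matrix

noncomputable section

/-- The automorphism `v ↦ A v` of an additive subgroup `H` of `ℚ ^ d` with `A H = H`. -/
def matrixAut {d : ℕ} (A : GL (Fin d) ℚ) (H : AddSubgroup (Fin d → ℚ))
    (hH : ∀ v, (A : Matrix (Fin d) (Fin d) ℚ) *ᵥ v ∈ H ↔ v ∈ H) : H ≃+ H where
  toFun v := ⟨(A : Matrix (Fin d) (Fin d) ℚ) *ᵥ v.1, (hH v.1).2 v.2⟩
  invFun v := ⟨((A⁻¹ : GL (Fin d) ℚ) : Matrix (Fin d) (Fin d) ℚ) *ᵥ v.1, by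
    rw [← hH, Matrix.mulVec_mulVec, ← Units.val_mul, mul_inv_cancel, Units.val_one,
      Matrix.one_mulVec]
    exact v.2⟩
  left_inv v := by
    apply Subtype.ext
    simp only [Matrix.mulVec_mulVec, ← Units.val_mul, inv_mul_cancel, Units.val_one,
      Matrix.one_mulVec]
  right_inv v := by
    apply Subtype.ext
    simp only [Matrix.mulVec_mulVec, ← Units.val_mul, mul_inv_cancel, Units.val_one,
      Matrix.one_mulVec]
  map_add' v w := by
    apply Subtype.ext
    simp only [AddSubgroup.coe_add, Matrix.mulVec_add]

/-- The group `ℤ ⋉_A H`: the semidirect product in which conjugation by the generator of `ℤ`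
acts on `H` as `A`. -/
abbrev MatrixSemidirect {d : ℕ} (A : GL (Fin d) ℚ) (H : AddSubgroup (Fin d → ℚ))
    (hH : ∀ v, (A : Matrix (Fin d) (Fin d) ℚ) *ᵥ v ∈ H ↔ v ∈ H) : Type :=
  Multiplicative H ⋊[zpowersHom (MulAut (Multiplicative H))
    (AddEquiv.toMultiplicative (matrixAut A H hH))] Multiplicative ℤ

/-- A self-homeomorphism of `[0,1]`, as a real function (constant outside `[0,1]`). -/
def onReal (f : unitInterval ≃ₜ unitInterval) : ℝ → ℝ :=
  Set.IccExtend (zero_le_one (α := ℝ)) (fun x => ((f x : unitInterval) : ℝ))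

/-- The derivative of a self-homeomorphism of `[0,1]`, one-sided at the endpoints. -/
def derivOn (f : unitInterval ≃ₜ unitInterval) (x : unitInterval) : ℝ :=
  derivWithin (onReal f) (Set.Icc 0 1) (x : ℝ)

/-- `f` is an orientation-preserving `C¹` diffeomorphism of `[0,1]`. -/
structure IsC1Diffeo (f : unitInterval ≃ₜ unitInterval) : Prop where
  strictMono : StrictMono f
  contDiffOn : ContDiffOn ℝ 1 (onReal f) (Set.Icc 0 1)
  contDiffOn_symm : ContDiffOn ℝ 1 (onReal f.symm) (Set.Icc 0 1)

/-- An action of `G` on `[0,1]` by orientation-preserving `C¹` diffeomorphisms. -/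
def IsC1Action {G : Type*} [Group G] (φ : G →* (unitInterval ≃ₜ unitInterval)) : Prop :=
  ∀ g, IsC1Diffeo (φ g)

/-- `f` and `g` are `ε`-close in the `C¹` metric. -/
def C1Close (ε : ℝ) (f g : unitInterval ≃ₜ unitInterval) : Prop :=
  ∀ x : unitInterval, |(f x : ℝ) - g x| < ε ∧ |derivOn f x - derivOn g x| < ε

/-- The homeomorphism `h` conjugates the action `φ` to the action `ψ`. -/
def Conjugates {G : Type*} [Group G] (h : unitInterval ≃ₜ unitInterval)
    (φ ψ : G →* (unitInterval ≃ₜ unitInterval)) : Prop :=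
  ∀ g x, h (φ g x) = ψ g (h x)

/-- `h` is Lipschitz. -/
def IsLipschitz (h : unitInterval ≃ₜ unitInterval) : Prop :=
  ∃ K : NNReal, LipschitzWith K h

end

/-! The action $\psi$ is the conjugate of $\varphi$ by a homeomorphism $h$ close to the identity,
the normalised primitive of a positive density $\rho$. The derivative of $hfh^{-1}$ at $h(x)$ is
$f'(x)\,\rho(f(x))/\rho(x)$, so the conjugate is $C^1$, and close to $f$, as soon as the cocycle
$\rho\circ f/\rho$ is continuous and close to $1$, even when $\rho$ itself is discontinuous or
unbounded.

A gap is a component of the complement of the set of global fixed points, and every $\varphi(g)$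
maps each gap to itself. In one chosen gap $(a,b)$, $\rho(x)=L(x-a)/L(b-x)$ with $L(d)=1-\eta\log
d$. Since $\varphi(g)$ is bi-Lipschitz, it changes $\log(x-a)$ and $\log(b-x)$ by bounded amounts,
so the cocycle tends to $1$ at both ends (`continuousOn_gapRatio`). But $\rho\to\infty$ at $a$ and
$\rho\to0$ at $b$. On any other gap, $\rho$ is a constant $u(\ell)/\ell$ depending only on the
length $\ell$, and the cocycle is $1$.

Every conjugacy from $\varphi$ to $\psi$ is $h\circ c$ with $c$ in the centralizer of $\varphi$, and
$c$ permutes the gaps. Two cases arise (`not_lipschitz_comp`).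

If some positive power of $c$ preserves $(a,b)$, let $c^{m+1}$ be the first one. As $h$ is affine on
the intermediate gaps, a Lipschitz bound for $h\circ c$ or its inverse gives one for $h\circ
c^{m+1}$ or its inverse on $[a,b]$. A commutative subgroup without fixed points in $(a,b)$
(`exists_commutative_subgroup`) supplies points accumulating at $a$, and others accumulating at $b$,
where the commuting map $c^{m+1}$ shrinks the distance to $a$, or expands the distance to $b$, by at
most a constant factor (`exists_mul_sub_le_left`, `exists_mul_sub_le_right`). This contradicts the
singularities of $h$.

If no positive power does, the images of $(a,b)$ are disjoint gaps with lengths tending to $0$. A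
Lipschitz bound then relates consecutive lengths through $u$, and $u$ is chosen to oscillate so
strongly around the identity (`exists_oscillating_length`) that no such sequence of lengths can get
past certain thresholds. -/

open Set Filter Topology MeasureTheory

/-! ### Gaps of a closed set -/

/-- The largest point of `P` that is at most `x`. -/
noncomputable def gapLeft (P : Set ℝ) (x : ℝ) : ℝ := sSup (P ∩ Iic x)

/-- The smallest point of `P` that is at least `x`. -/
noncomputable def gapRight (P : Set ℝ) (x : ℝ) : ℝ := sInf (P ∩ Ici x)

/-- The length of the component of the complement of `P` around `x` (`0` on `P`). -/
noncomputable def gapLength (P : Set ℝ) (x : ℝ) : ℝ := gapRight P x - gapLeft P x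

/-- A closed subset of the line containing the complement of `(0,1)`. -/
structure IsGapSet (P : Set ℝ) : Prop where
  closed : IsClosed P
  Iic_subset : Iic 0 ⊆ P
  Ici_subset : Ici 1 ⊆ P

namespace IsGapSet

variable {P : Set ℝ}

lemma nonempty_left (hP : IsGapSet P) (x : ℝ) : (P ∩ Iic x).Nonempty :=
  ⟨min x 0, hP.Iic_subset (mem_Iic.2 (min_le_right _ _)), mem_Iic.2 (min_le_left _ _)⟩

lemma nonempty_right (hP : IsGapSet P) (x : ℝ) : (P ∩ Ici x).Nonempty :=
  ⟨max x 1, hP.Ici_subset (mem_Ici.2 (le_max_right _ _)), mem_Ici.2 (le_max_left _ _)⟩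

lemma gapLeft_mem_inter (hP : IsGapSet P) (x : ℝ) : gapLeft P x ∈ P ∩ Iic x :=
  (hP.closed.inter isClosed_Iic).csSup_mem (hP.nonempty_left x) ⟨x, fun _ h => h.2⟩

lemma gapRight_mem_inter (hP : IsGapSet P) (x : ℝ) : gapRight P x ∈ P ∩ Ici x :=
  (hP.closed.inter isClosed_Ici).csInf_mem (hP.nonempty_right x) ⟨x, fun _ h => h.2⟩

lemma gapLeft_mem (hP : IsGapSet P) (x : ℝ) : gapLeft P x ∈ P := (hP.gapLeft_mem_inter x).1
lemma gapRight_mem (hP : IsGapSet P) (x : ℝ) : gapRight P x ∈ P := (hP.gapRight_mem_inter x).1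
lemma gapLeft_le (hP : IsGapSet P) (x : ℝ) : gapLeft P x ≤ x := (hP.gapLeft_mem_inter x).2
lemma le_gapRight (hP : IsGapSet P) (x : ℝ) : x ≤ gapRight P x := (hP.gapRight_mem_inter x).2

lemma le_gapLeft (_hP : IsGapSet P) {x p : ℝ} (hp : p ∈ P) (h : p ≤ x) : p ≤ gapLeft P x :=
  le_csSup ⟨x, fun _ h => h.2⟩ ⟨hp, h⟩

lemma gapRight_le (_hP : IsGapSet P) {x p : ℝ} (hp : p ∈ P) (h : x ≤ p) : gapRight P x ≤ p :=
  csInf_le ⟨x, fun _ h => h.2⟩ ⟨hp, h⟩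

lemma gapLength_nonneg (hP : IsGapSet P) (x : ℝ) : 0 ≤ gapLength P x :=
  sub_nonneg.2 ((hP.gapLeft_le x).trans (hP.le_gapRight x))

lemma gapLeft_lt (hP : IsGapSet P) {x : ℝ} (hx : x ∉ P) : gapLeft P x < x :=
  lt_of_le_of_ne (hP.gapLeft_le x) fun h => hx (h ▸ hP.gapLeft_mem x)

lemma lt_gapRight (hP : IsGapSet P) {x : ℝ} (hx : x ∉ P) : x < gapRight P x :=
  lt_of_le_of_ne (hP.le_gapRight x) fun h => hx (h ▸ hP.gapRight_mem x)

lemma not_mem_of_mem_Ioo (hP : IsGapSet P) {x y : ℝ} (hy : y ∈ Ioo (gapLeft P x) (gapRight P x)) :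
    y ∉ P := by
  intro hyP
  rcases le_total y x with h | h
  · exact absurd (hP.le_gapLeft hyP h) (not_le.2 hy.1)
  · exact absurd (hP.gapRight_le hyP h) (not_le.2 hy.2)

lemma gapLeft_eq (hP : IsGapSet P) {p q x : ℝ} (hp : p ∈ P) (hx : x ∈ Ioo p q) (h : ∀ y ∈ Ioo p q, y ∉ P) :
    gapLeft P x = p := by
  refine le_antisymm ?_ (hP.le_gapLeft hp hx.1.le)
  by_contra! hlt
  exact h _ ⟨hlt, (hP.gapLeft_le x).trans_lt hx.2⟩ (hP.gapLeft_mem x)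

lemma gapRight_eq (hP : IsGapSet P) {p q x : ℝ} (hq : q ∈ P) (hx : x ∈ Ioo p q) (h : ∀ y ∈ Ioo p q, y ∉ P) :
    gapRight P x = q := by
  refine le_antisymm (hP.gapRight_le hq hx.2.le) ?_
  by_contra! hlt
  exact h _ ⟨hx.1.trans_le (hP.le_gapRight x), hlt⟩ (hP.gapRight_mem x)

lemma gapLength_eq (hP : IsGapSet P) {p q x : ℝ} (hp : p ∈ P) (hq : q ∈ P) (hx : x ∈ Ioo p q)
    (h : ∀ y ∈ Ioo p q, y ∉ P) : gapLength P x = q - p := by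
  rw [gapLength, hP.gapLeft_eq hp hx h, hP.gapRight_eq hq hx h]

lemma monotone_gapLeft (hP : IsGapSet P) : Monotone (gapLeft P) := fun _ _ h =>
  hP.le_gapLeft (hP.gapLeft_mem _) ((hP.gapLeft_le _).trans h)

lemma monotone_gapRight (hP : IsGapSet P) : Monotone (gapRight P) := fun _ _ h =>
  hP.gapRight_le (hP.gapRight_mem _) (h.trans (hP.le_gapRight _))

lemma measurable_gapLength (hP : IsGapSet P) : Measurable (gapLength P) :=
  hP.monotone_gapRight.measurable.sub hP.monotone_gapLeft.measurable

lemma gapLeft_nonneg (hP : IsGapSet P) {x : ℝ} (hx : 0 ≤ x) : 0 ≤ gapLeft P x :=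
  hP.le_gapLeft (hP.Iic_subset (mem_Iic.2 le_rfl)) hx

lemma gapRight_le_one (hP : IsGapSet P) {x : ℝ} (hx : x ≤ 1) : gapRight P x ≤ 1 :=
  hP.gapRight_le (hP.Ici_subset (mem_Ici.2 le_rfl)) hx

/-- An increasing map that fixes both ends of a gap keeps the gap invariant. A density that is a
function of the gap length is therefore invariant under such a map. -/
lemma gapLength_map (hP : IsGapSet P) {F : ℝ → ℝ} (hF : StrictMonoOn F (Icc 0 1))
    (hfix : ∀ x ∈ Icc (0 : ℝ) 1, x ∈ P → F x = x) {x : ℝ} (hx : x ∈ Icc (0 : ℝ) 1) :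
    gapLength P (F x) = gapLength P x := by
  by_cases hxP : x ∈ P
  · rw [hfix x hx hxP]
  have hp := hP.gapLeft_lt hxP
  have hq := hP.lt_gapRight hxP
  have h0 := hP.gapLeft_nonneg hx.1
  have h1 := hP.gapRight_le_one hx.2
  have hpI : gapLeft P x ∈ Icc (0 : ℝ) 1 := ⟨h0, by linarith [hx.2]⟩
  have hqI : gapRight P x ∈ Icc (0 : ℝ) 1 := ⟨by linarith [hx.1], h1⟩
  refine hP.gapLength_eq (hP.gapLeft_mem x) (hP.gapRight_mem x) ⟨?_, ?_⟩
    fun y hy => hP.not_mem_of_mem_Ioo hy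
  · calc gapLeft P x = F (gapLeft P x) := (hfix _ hpI (hP.gapLeft_mem x)).symm
      _ < F x := hF hpI hx hp
  · calc F x < F (gapRight P x) := hF hx hqI hq
      _ = gapRight P x := hfix _ hqI (hP.gapRight_mem x)

end IsGapSet

/-! ### An oscillating function of the gap length -/

/-- The slope `u s / s`, with the value `1` at `s = 0`. -/
noncomputable def slopeAt (u : ℝ → ℝ) (s : ℝ) : ℝ := if s = 0 then 1 else u s / s

lemma slopeAt_pos {u : ℝ → ℝ} (hu : ∀ s, 0 < s → 0 < u s) {s : ℝ} (hs : 0 ≤ s) :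
    0 < slopeAt u s := by
  unfold slopeAt
  split_ifs with h
  · exact one_pos
  · have := lt_of_le_of_ne hs (Ne.symm h)
    exact div_pos (hu s this) this

lemma measurable_slopeAt {u : ℝ → ℝ} (hu : Measurable u) : Measurable (slopeAt u) :=
  Measurable.ite (measurableSet_singleton 0) measurable_const (hu.div measurable_id)

/-- Continuity from above: the sets decrease to the empty set. The condition `0 < l x` is essential,
since the zero set of `l` may have positive measure. -/
lemma exists_measure_small_values_le (μ : Measure ℝ) [IsFiniteMeasure μ] {l : ℝ → ℝ}
    (hl : Measurable l) {δ : ENNReal} (hδ : 0 < δ) :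
    ∃ T : ℝ, 0 < T ∧ μ {x | 0 < l x ∧ l x < T} ≤ δ := by
  have h := tendsto_measure_iInter_atTop (μ := μ)
    (s := fun n : ℕ => {x | 0 < l x ∧ l x < 1 / ((n : ℝ) + 1)})
    (fun n => ((measurableSet_lt measurable_const hl).inter
      (measurableSet_lt hl measurable_const)).nullMeasurableSet)
    (fun n m hnm x hx => ⟨hx.1, hx.2.trans_le (Nat.one_div_le_one_div hnm)⟩)
    ⟨0, measure_ne_top _ _⟩
  have he : (⋂ n : ℕ, {x | 0 < l x ∧ l x < 1 / ((n : ℝ) + 1)}) = ∅ := by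
    ext x
    simp only [mem_iInter, mem_ofPred_eq, mem_empty_iff_false, iff_false, not_forall]
    by_cases hx : 0 < l x
    · obtain ⟨n, hn⟩ := exists_nat_one_div_lt hx
      exact ⟨n, fun h => absurd h.2 (not_lt.2 hn.le)⟩
    · exact ⟨0, fun h => hx h.1⟩
  rw [he, measure_empty] at h
  obtain ⟨n, hn⟩ := ((h.eventually (ge_mem_nhds hδ))).exists
  exact ⟨_, Nat.one_div_pos_of_nat, hn⟩

/-- A sequence of thresholds decreasing fast, below given bounds. -/
noncomputable def thresholds (τ : ℕ → ℝ) : ℕ → ℝ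
  | 0 => τ 0
  | k + 1 => min (τ (k + 1)) (thresholds τ k / ((k : ℝ) + 1) ^ 2)

section thresholds

variable {τ : ℕ → ℝ}

lemma thresholds_pos (hτ : ∀ k, 0 < τ k) (k : ℕ) : 0 < thresholds τ k := by
  induction k with
  | zero => exact hτ 0
  | succ k ih => exact lt_min (hτ _) (by positivity)

lemma thresholds_le (k : ℕ) : thresholds τ k ≤ τ k := by
  cases k with
  | zero => exact le_rfl
  | succ k => exact min_le_left _ _

/-- Of the two factors `k + 1`, one pays for the slope `k + 1` of the step function at `T (k + 1)`,
and the other keeps the function a factor `k + 1` below `T k` on the left of `T k`. -/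
lemma sq_mul_thresholds_succ_le (k : ℕ) :
    ((k : ℝ) + 1) ^ 2 * thresholds τ (k + 1) ≤ thresholds τ k := by
  have h : thresholds τ (k + 1) ≤ thresholds τ k / ((k : ℝ) + 1) ^ 2 := min_le_right _ _
  rwa [le_div_iff₀' (by positivity)] at h

lemma antitone_thresholds (hτ : ∀ k, 0 < τ k) : Antitone (thresholds τ) := by
  refine antitone_nat_of_succ_le fun k => ?_
  have h1 := sq_mul_thresholds_succ_le (τ := τ) k
  have h2 := thresholds_pos hτ (k + 1)
  have h3 : (1 : ℝ) ≤ ((k : ℝ) + 1) ^ 2 := by nlinarith [(Nat.cast_nonneg k : (0 : ℝ) ≤ k)]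
  nlinarith

lemma succ_mul_thresholds_le (k : ℕ) :
    ((k : ℝ) + 1) * (((k : ℝ) + 1) * thresholds τ (k + 1)) ≤ thresholds τ k := by
  linarith [sq_mul_thresholds_succ_le (τ := τ) k]

lemma antitone_mul_thresholds (hτ : ∀ k, 0 < τ k) :
    Antitone fun k : ℕ => ((k : ℝ) + 1) * thresholds τ (k + 1) := by
  refine antitone_nat_of_succ_le fun k => ?_
  have h1 := succ_mul_thresholds_le (τ := τ) (k + 1)
  have h2 := thresholds_pos hτ (k + 1)
  have h3 := thresholds_pos hτ (k + 1 + 1)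
  have h4 : (0 : ℝ) ≤ k := Nat.cast_nonneg k
  push_cast at *
  have h5 : 0 < ((k : ℝ) + 1 + 1) * thresholds τ (k + 1 + 1) := by positivity
  nlinarith

lemma tendsto_thresholds (hτ : ∀ k, 0 < τ k) :
    Tendsto (thresholds τ) atTop (𝓝 0) := by
  rw [← tendsto_add_atTop_iff_nat 1]
  refine squeeze_zero (fun k => (thresholds_pos hτ _).le) (fun k => ?_)
    (by simpa using (tendsto_one_div_add_atTop_nhds_zero_nat (𝕜 := ℝ)).mul_const (thresholds τ 0))
  have h1 := sq_mul_thresholds_succ_le (τ := τ) k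
  have h2 := antitone_thresholds hτ (Nat.zero_le k)
  have h3 := thresholds_pos hτ (k + 1)
  have h4 : (0 : ℝ) ≤ k := Nat.cast_nonneg k
  rw [← div_eq_inv_mul, le_div_iff₀ (by positivity)]
  nlinarith [mul_nonneg h4 h3.le, mul_nonneg h4 (mul_nonneg h4 h3.le)]

end thresholds

/-- The step function that is `(k + 1) T (k + 1)` between `T (k + 1)` and `T k`, and the identity
above `T 0`. -/
noncomputable def stepFun (T : ℕ → ℝ) (s : ℝ) : ℝ :=
  if T 0 ≤ s then s else (sInf {k : ℕ | T k ≤ s} : ℕ) * T (sInf {k : ℕ | T k ≤ s})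

/-- The first index with `T k ≤ s` is not `0` because `s < T 0`; it is written `k + 1`. -/
lemma stepFun_spec {T : ℕ → ℝ} (hT : Antitone T) (hlim : Tendsto T atTop (𝓝 0)) {s : ℝ}
    (hs : 0 < s) (hs0 : s < T 0) :
    ∃ k : ℕ, stepFun T s = ((k : ℝ) + 1) * T (k + 1) ∧ ∀ j, T j ≤ s ↔ k + 1 ≤ j := by
  have hne : {k : ℕ | T k ≤ s}.Nonempty := (hlim.eventually (ge_mem_nhds hs)).exists
  have hmem : T (sInf {k : ℕ | T k ≤ s}) ≤ s := Nat.sInf_mem hne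
  obtain ⟨k, hk⟩ : ∃ k, sInf {k : ℕ | T k ≤ s} = k + 1 := by
    refine Nat.exists_eq_succ_of_ne_zero fun h => ?_
    rw [h] at hmem
    linarith
  refine ⟨k, ?_, fun j => ⟨fun h => ?_, fun h => ?_⟩⟩
  · rw [stepFun, if_neg (not_le.2 hs0), hk]
    push_cast
    rfl
  · rw [← hk]
    exact Nat.sInf_le h
  · rw [hk] at hmem
    exact (hT h).trans hmem

/-- No threshold is below `s`, and the infimum of the empty set of naturals is `0`, which
annihilates the first factor. -/
lemma stepFun_of_nonpos {T : ℕ → ℝ} (hT : ∀ k, 0 < T k) {s : ℝ} (hs : s ≤ 0) :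
    stepFun T s = 0 := by
  have : {k : ℕ | T k ≤ s} = ∅ := by
    ext k
    simpa using hs.trans_lt (hT k)
  rw [stepFun, if_neg (not_le.2 (hs.trans_lt (hT 0))), this]
  simp

section stepFun

variable {τ : ℕ → ℝ}

lemma stepFun_pos (hτ : ∀ k, 0 < τ k) {s : ℝ} (hs : 0 < s) : 0 < stepFun (thresholds τ) s := by
  by_cases h : thresholds τ 0 ≤ s
  · rwa [stepFun, if_pos h]
  · obtain ⟨k, hk, -⟩ := stepFun_spec (antitone_thresholds hτ) (tendsto_thresholds hτ) hs
      (not_le.1 h)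
    rw [hk]
    have := thresholds_pos hτ (k + 1)
    positivity

lemma monotone_stepFun (hτ : ∀ k, 0 < τ k) : Monotone (stepFun (thresholds τ)) := by
  intro s t hst
  rcases le_or_gt s 0 with hs | hs
  · rw [stepFun_of_nonpos (thresholds_pos hτ) hs]
    rcases le_or_gt t 0 with ht | ht
    · rw [stepFun_of_nonpos (thresholds_pos hτ) ht]
    · exact (stepFun_pos hτ ht).le
  by_cases h : thresholds τ 0 ≤ s
  · rwa [stepFun, stepFun, if_pos h, if_pos (h.trans hst)]
  · obtain ⟨k, hk, hk'⟩ := stepFun_spec (antitone_thresholds hτ) (tendsto_thresholds hτ) hs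
      (not_le.1 h)
    rw [hk]
    by_cases ht : thresholds τ 0 ≤ t
    · rw [stepFun, if_pos ht]
      -- Below `T 0` the values are at most `T 1 ≤ T 0`, where the identity takes over.
      have h1 := antitone_mul_thresholds hτ (Nat.zero_le k)
      have h2 := sq_mul_thresholds_succ_le (τ := τ) 0
      simp only [Nat.cast_zero, zero_add, one_pow, one_mul] at h1 h2
      linarith
    · obtain ⟨j, hj, hj'⟩ := stepFun_spec (antitone_thresholds hτ) (tendsto_thresholds hτ)
        (hs.trans_le hst) (not_le.1 ht)
      rw [hj]
      exact antitone_mul_thresholds hτ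
        (Nat.le_of_succ_le_succ ((hj' _).1 (((hk' _).2 le_rfl).trans hst)))

lemma frequently_mul_le_stepFun (hτ : ∀ k, 0 < τ k) (K : ℝ) :
    ∃ᶠ T in 𝓝[>] 0, K * T ≤ stepFun (thresholds τ) T := by
  have hlim : Tendsto (fun k => thresholds τ (k + 1)) atTop (𝓝[>] 0) :=
    tendsto_nhdsWithin_iff.2 ⟨(tendsto_add_atTop_iff_nat 1).2 (tendsto_thresholds hτ),
      .of_forall fun k => thresholds_pos hτ _⟩
  refine hlim.frequently (Eventually.frequently ?_)
  filter_upwards [tendsto_natCast_atTop_atTop.eventually_ge_atTop (max K 0)] with k hk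
  have hp := thresholds_pos hτ (k + 1)
  -- The thresholds need not be strictly decreasing: `T 1 = T 0` is possible, and then `T 1` falls
  -- in the identity branch.
  by_cases h : thresholds τ 0 ≤ thresholds τ (k + 1)
  · rw [stepFun, if_pos h]
    have h1 := antitone_mul_thresholds hτ (Nat.zero_le k)
    have h2 := sq_mul_thresholds_succ_le (τ := τ) 0
    simp only [Nat.cast_zero, zero_add, one_pow, one_mul] at h1 h2
    have : K * thresholds τ (k + 1) ≤ ((k : ℝ) + 1) * thresholds τ (k + 1) := by
      gcongr
      linarith [le_max_left K 0]
    linarith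
  · obtain ⟨j, hj, hj'⟩ := stepFun_spec (antitone_thresholds hτ) (tendsto_thresholds hτ) hp
      (not_le.1 h)
    rw [hj]
    refine le_trans ?_ (antitone_mul_thresholds hτ (Nat.le_of_succ_le_succ ((hj' (k + 1)).1 le_rfl)))
    show K * _ ≤ ((k : ℝ) + 1) * _
    gcongr
    linarith [le_max_left K 0]

/-- Left of `T k` the values are at most `(k + 1) T (k + 1)`, hence at most `T k / (k + 1)`. -/
lemma frequently_mul_stepFun_le (hτ : ∀ k, 0 < τ k) (K : ℝ) :
    ∃ᶠ T in 𝓝[>] 0, ∀ s < T, K * stepFun (thresholds τ) s ≤ T := by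
  have hlim : Tendsto (thresholds τ) atTop (𝓝[>] 0) :=
    tendsto_nhdsWithin_iff.2 ⟨tendsto_thresholds hτ,
      .of_forall fun k => thresholds_pos hτ _⟩
  refine hlim.frequently (Eventually.frequently ?_)
  filter_upwards [tendsto_natCast_atTop_atTop.eventually_ge_atTop (max K 0)] with k hk s hs
  rcases le_or_gt s 0 with hs0 | hs0
  · rw [stepFun_of_nonpos (thresholds_pos hτ) hs0]
    simpa using (thresholds_pos hτ k).le
  obtain ⟨j, hj, hj'⟩ := stepFun_spec (antitone_thresholds hτ) (tendsto_thresholds hτ) hs0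
    (hs.trans_le (antitone_thresholds hτ (Nat.zero_le k)))
  have hkj : k ≤ j := by
    by_contra! hlt
    exact absurd ((hj' k).2 hlt) (not_le.2 hs)
  rw [hj]
  have h1 := antitone_mul_thresholds hτ hkj
  have h2 := succ_mul_thresholds_le (τ := τ) k
  have h3 := thresholds_pos hτ (j + 1)
  have h4 : 0 ≤ ((j : ℝ) + 1) * thresholds τ (j + 1) := by positivity
  simp only at h1
  calc K * (((j : ℝ) + 1) * thresholds τ (j + 1))
      ≤ ((k : ℝ) + 1) * (((j : ℝ) + 1) * thresholds τ (j + 1)) := by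
        gcongr
        linarith [le_max_left K 0]
    _ ≤ ((k : ℝ) + 1) * (((k : ℝ) + 1) * thresholds τ (k + 1)) := by gcongr
    _ ≤ _ := h2

/-- For `T (k + 1) ≤ s < T k` the slope lies between `0` and `k + 1`, while `s` is below each of the
`k + 1` thresholds `T 0, …, T k`. The integral of the left side is thus controlled by the measures
of the sets of small gap lengths. -/
lemma enorm_slopeAt_stepFun_sub_one_le (hτ : ∀ k, 0 < τ k) {s : ℝ} (hs : 0 ≤ s) :
    ‖slopeAt (stepFun (thresholds τ)) s - 1‖ₑ ≤
      ∑' k, {s | 0 < s ∧ s < thresholds τ k}.indicator (fun _ => (1 : ENNReal)) s := by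
  rcases hs.eq_or_lt with rfl | hs
  · simp [slopeAt]
  by_cases h : thresholds τ 0 ≤ s
  · simp [slopeAt, stepFun, h, hs.ne']
  obtain ⟨k, hk, hk'⟩ := stepFun_spec (antitone_thresholds hτ) (tendsto_thresholds hτ) hs
      (not_le.1 h)
  refine le_trans ?_ (ENNReal.sum_le_tsum (Finset.range (k + 1)))
  have hsum : ∑ j ∈ Finset.range (k + 1),
      {s | 0 < s ∧ s < thresholds τ j}.indicator (fun _ => (1 : ENNReal)) s = (k + 1 : ℕ) := by
    rw [Finset.sum_congr rfl (g := fun _ => 1), Finset.sum_const, Finset.card_range, nsmul_one]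
    intro j hj
    rw [indicator_of_mem]
    refine ⟨hs, not_le.1 fun hle => ?_⟩
    have := (hk' j).1 hle
    rw [Finset.mem_range] at hj
    omega
  rw [hsum, Real.enorm_eq_ofReal_abs, ← ENNReal.ofReal_natCast]
  refine ENNReal.ofReal_le_ofReal ?_
  have h1 := (hk' (k + 1)).2 le_rfl
  have h2 := thresholds_pos hτ (k + 1)
  have h3 : (0 : ℝ) ≤ k := Nat.cast_nonneg k
  rw [slopeAt, if_neg hs.ne', hk, abs_le]
  have h4 : ((k : ℝ) + 1) * thresholds τ (k + 1) / s ≤ k + 1 := by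
    rw [div_le_iff₀ hs]
    gcongr
  have h5 : 0 ≤ ((k : ℝ) + 1) * thresholds τ (k + 1) / s := by positivity
  push_cast
  constructor <;> linarith

end stepFun

theorem exists_oscillating_length (μ : Measure ℝ) [IsFiniteMeasure μ] {l : ℝ → ℝ}
    (hl : Measurable l) (hnn : ∀ x, 0 ≤ l x) {δ : ℝ} (hδ : 0 < δ) :
    ∃ u : ℝ → ℝ, Monotone u ∧ (∀ s, 0 < s → 0 < u s) ∧
      ∫⁻ x, ‖slopeAt u (l x) - 1‖ₑ ∂μ ≤ ENNReal.ofReal δ ∧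
      (∀ K, ∃ᶠ T in 𝓝[>] 0, K * T ≤ u T) ∧
      (∀ K, ∃ᶠ T in 𝓝[>] 0, ∀ s < T, K * u s ≤ T) := by
  obtain ⟨δ', hδ', hsum⟩ := ENNReal.exists_pos_sum_of_countable
    (ENNReal.ofReal_pos.2 hδ).ne' ℕ
  choose τ hτ hμ using fun k =>
    exists_measure_small_values_le μ hl (ENNReal.coe_pos.2 (hδ' k))
  refine ⟨stepFun (thresholds τ), monotone_stepFun hτ, fun s => stepFun_pos hτ, ?_,
    frequently_mul_le_stepFun hτ, frequently_mul_stepFun_le hτ⟩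
  have hmeas : ∀ k, MeasurableSet {x | 0 < l x ∧ l x < thresholds τ k} := fun k =>
    (measurableSet_lt measurable_const hl).inter (measurableSet_lt hl measurable_const)
  calc ∫⁻ x, ‖slopeAt (stepFun (thresholds τ)) (l x) - 1‖ₑ ∂μ
      ≤ ∫⁻ x, ∑' k, {x | 0 < l x ∧ l x < thresholds τ k}.indicator (fun _ => (1 : ENNReal)) x ∂μ :=
        lintegral_mono fun x => enorm_slopeAt_stepFun_sub_one_le hτ (hnn x)
    _ = ∑' k, μ {x | 0 < l x ∧ l x < thresholds τ k} := by
        rw [lintegral_tsum fun k => (measurable_const.indicator (hmeas k)).aemeasurable]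
        exact tsum_congr fun k => by
          rw [lintegral_indicator_const (hmeas k), one_mul]
    _ ≤ ∑' k, (δ' k : ENNReal) := ENNReal.tsum_le_tsum fun k =>
        le_trans (measure_mono (s := {x | 0 < l x ∧ l x < thresholds τ k})
          (t := {x | 0 < l x ∧ l x < τ k})
          fun x hx => And.intro hx.1 (hx.2.trans_le (thresholds_le k))) (hμ k)
    _ ≤ ENNReal.ofReal δ := hsum.le

/-- A scale `T` with `u T` much larger than `T` is a barrier: if `e n ≥ T`, then `K * e (n + 1) ≥ u
(e n) ≥ u T` forces `e (n + 1) ≥ T`. -/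
lemma not_tendsto_zero_of_mul_le {u : ℝ → ℝ} (hu : Monotone u)
    (hA : ∀ K, ∃ᶠ T in 𝓝[>] 0, K * T ≤ u T) {e : ℕ → ℝ} (he : ∀ n, 0 < e n) {K : ℝ}
    (h : ∀ n, u (e n) ≤ K * e (n + 1)) : ¬ Tendsto e atTop (𝓝 0) := by
  intro hlim
  obtain ⟨T, hT, hT0, hTe⟩ := ((hA (max K 0 + 1)).and_eventually
    (Ioo_mem_nhdsGT (he 0))).exists
  have hmain : ∀ n, T ≤ e n := by
    intro n
    induction n with
    | zero => exact hTe.le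
    | succ n ih =>
      by_contra! hlt
      have h1 := hu ih
      have h2 := h n
      have h3 : K * e (n + 1) ≤ max K 0 * e (n + 1) :=
        mul_le_mul_of_nonneg_right (le_max_left _ _) (he _).le
      have h4 : max K 0 * e (n + 1) ≤ max K 0 * T :=
        mul_le_mul_of_nonneg_left hlt.le (le_max_right _ _)
      linarith
  exact absurd (ge_of_tendsto' hlim hmain) (not_le.2 hT0)

/-- The opposite barrier: when `u` is much smaller than `T` everywhere left of `T`, a term `e (n +
1) < T` would force `e n < T`. -/
lemma not_tendsto_zero_of_le_mul {u : ℝ → ℝ}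
    (hB : ∀ K, ∃ᶠ T in 𝓝[>] 0, ∀ s < T, K * u s ≤ T) (hpos : ∀ s, 0 < s → 0 < u s)
    {e : ℕ → ℝ} (he : ∀ n, 0 < e n) {K : ℝ}
    (h : ∀ n, e n ≤ K * u (e (n + 1))) : ¬ Tendsto e atTop (𝓝 0) := by
  intro hlim
  obtain ⟨T, hT, hT0, hTe⟩ := ((hB (max K 0 + 1)).and_eventually
    (Ioo_mem_nhdsGT (he 0))).exists
  have hmain : ∀ n, T ≤ e n := by
    intro n
    induction n with
    | zero => exact hTe.le
    | succ n ih =>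
      by_contra! hlt
      have h1 := hT _ hlt
      have h2 := h n
      have h3 := hpos _ (he (n + 1))
      have h4 : K * u (e (n + 1)) ≤ max K 0 * u (e (n + 1)) :=
        mul_le_mul_of_nonneg_right (le_max_left _ _) h3.le
      linarith
  exact absurd (ge_of_tendsto' hlim hmain) (not_le.2 hT0)

/-! ### Conjugation by the primitive of a density -/

/-- The homeomorphism `h` of `[0,1]` is the primitive of the positive integrable function `ρ`. -/
structure HasDensity (h : unitInterval ≃ₜ unitInterval) (ρ : ℝ → ℝ) : Prop where
  pos : ∀ x, 0 < ρ x
  integrableOn : IntegrableOn ρ (Icc 0 1)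
  sub_eq : ∀ x y : unitInterval, (h y : ℝ) - h x = ∫ t in (x : ℝ)..y, ρ t

lemma intervalIntegrable_of_mem {ρ : ℝ → ℝ} (hint : IntegrableOn ρ (Icc 0 1)) {x y : ℝ}
    (hx : x ∈ Icc (0 : ℝ) 1) (hy : y ∈ Icc (0 : ℝ) 1) : IntervalIntegrable ρ volume x y :=
  (hint.mono_set (ordConnected_Icc.uIcc_subset hx hy)).intervalIntegrable

lemma integral_pos_of_lt {ρ : ℝ → ℝ} (hpos : ∀ x, 0 < ρ x) (hint : IntegrableOn ρ (Icc 0 1))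
    {x y : ℝ} (hx : x ∈ Icc (0 : ℝ) 1) (hy : y ∈ Icc (0 : ℝ) 1) (hxy : x < y) :
    0 < ∫ t in x..y, ρ t :=
  intervalIntegral.intervalIntegral_pos_of_pos (intervalIntegrable_of_mem hint hx hy) hpos hxy

theorem exists_hasDensity {ρ : ℝ → ℝ} (hpos : ∀ x, 0 < ρ x) (hint : IntegrableOn ρ (Icc 0 1)) :
    ∃ h : unitInterval ≃ₜ unitInterval, StrictMono h ∧
      HasDensity h fun x => (∫ t in (0 : ℝ)..1, ρ t)⁻¹ * ρ x := by
  set M := ∫ t in (0 : ℝ)..1, ρ t with hM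
  have h0 : (0 : ℝ) ∈ Icc (0 : ℝ) 1 := by simp
  have h1 : (1 : ℝ) ∈ Icc (0 : ℝ) 1 := by simp
  have hMpos : 0 < M := integral_pos_of_lt hpos hint h0 h1 one_pos
  set σ : ℝ → ℝ := fun x => M⁻¹ * ρ x with hσ
  have hσpos : ∀ x, 0 < σ x := fun x => mul_pos (inv_pos.2 hMpos) (hpos x)
  have hσint : IntegrableOn σ (Icc 0 1) := hint.const_mul _
  have hσ1 : ∫ t in (0 : ℝ)..1, σ t = 1 := by
    rw [intervalIntegral.integral_const_mul, ← hM, inv_mul_cancel₀ hMpos.ne']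
  set H : ℝ → ℝ := fun x => ∫ t in (0 : ℝ)..x, σ t with hH
  have hsub : ∀ x ∈ Icc (0 : ℝ) 1, ∀ y ∈ Icc (0 : ℝ) 1, H y - H x = ∫ t in x..y, σ t :=
    fun x hx y hy => intervalIntegral.integral_interval_sub_left
      (intervalIntegrable_of_mem hσint h0 hy) (intervalIntegrable_of_mem hσint h0 hx)
  have hmono : StrictMonoOn H (Icc 0 1) := fun x hx y hy hxy => by
    have := integral_pos_of_lt hσpos hσint hx hy hxy
    rw [← hsub x hx y hy] at this
    linarith
  have hH0 : H 0 = 0 := intervalIntegral.integral_same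
  have hH1 : H 1 = 1 := hσ1
  have hcont : ContinuousOn H (Icc 0 1) := by
    have := intervalIntegral.continuousOn_primitive_interval (a := (0 : ℝ)) (b := 1) (μ := volume)
      (f := σ) (by rwa [uIcc_of_le zero_le_one])
    rwa [uIcc_of_le zero_le_one] at this
  have hmem : ∀ x : unitInterval, H x ∈ Icc (0 : ℝ) 1 := fun x =>
    ⟨hH0 ▸ hmono.monotoneOn h0 x.2 x.2.1, hH1 ▸ hmono.monotoneOn x.2 h1 x.2.2⟩
  let k : unitInterval → unitInterval := fun x => ⟨H x, hmem x⟩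
  have hk : StrictMono k := fun x y hxy => hmono x.2 y.2 hxy
  have hsurj : Function.Surjective k := fun y => by
    obtain ⟨x, hx, hxy⟩ := intermediate_value_Icc zero_le_one hcont
      (show (y : ℝ) ∈ Icc (H 0) (H 1) by rw [hH0, hH1]; exact y.2)
    exact ⟨⟨x, hx⟩, Subtype.ext hxy⟩
  refine ⟨(hk.orderIsoOfSurjective k hsurj).toHomeomorph, hk, hσpos, hσint, fun x y => ?_⟩
  exact hsub x x.2 y y.2

section C1

variable {f h : unitInterval ≃ₜ unitInterval} {ρ r : ℝ → ℝ}

lemma onReal_coe (f : unitInterval ≃ₜ unitInterval) (x : unitInterval) :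
    onReal f x = f x := IccExtend_val _ _ x

lemma onReal_of_mem (f : unitInterval ≃ₜ unitInterval) {x : ℝ} (hx : x ∈ Icc (0 : ℝ) 1) :
    onReal f x = f ⟨x, hx⟩ := IccExtend_of_mem _ _ hx

namespace IsC1Diffeo

lemma strictMonoOn (hf : IsC1Diffeo f) : StrictMonoOn (onReal f) (Icc 0 1) :=
  fun x hx y hy hxy => by
    rw [onReal_of_mem f hx, onReal_of_mem f hy]
    exact hf.strictMono (show (⟨x, hx⟩ : unitInterval) < ⟨y, hy⟩ from hxy)

lemma hasDerivWithinAt (hf : IsC1Diffeo f) {x : ℝ} (hx : x ∈ Icc (0 : ℝ) 1) :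
    HasDerivWithinAt (onReal f) (derivWithin (onReal f) (Icc 0 1) x) (Icc 0 1) x :=
  (hf.contDiffOn.differentiableOn one_ne_zero x hx).hasDerivWithinAt

lemma continuousOn_derivWithin (hf : IsC1Diffeo f) :
    ContinuousOn (derivWithin (onReal f) (Icc 0 1)) (Icc 0 1) :=
  hf.contDiffOn.continuousOn_derivWithin (uniqueDiffOn_Icc zero_lt_one) le_rfl

lemma derivWithin_nonneg (hf : IsC1Diffeo f) (x : ℝ) :
    0 ≤ derivWithin (onReal f) (Icc 0 1) x :=
  hf.strictMonoOn.monotoneOn.derivWithin_nonneg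

end IsC1Diffeo

lemma integral_comp_eq (hf : IsC1Diffeo f) {x y : unitInterval} (hxy : x ≤ y) :
    ∫ t in (f x : ℝ)..f y, ρ t =
      ∫ t in (x : ℝ)..y, derivWithin (onReal f) (Icc 0 1) t * ρ (onReal f t) := by
  have hxy' : (x : ℝ) ≤ y := hxy
  have hf' : (f x : ℝ) ≤ f y := hf.strictMono.monotone hxy
  have hsub : Icc (x : ℝ) y ⊆ Icc 0 1 := Icc_subset_Icc x.2.1 y.2.2
  have himage : onReal f '' Icc x y = Icc (f x : ℝ) (f y) := by
    apply Subset.antisymm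
    · rintro _ ⟨t, ht, rfl⟩
      rw [← onReal_coe, ← onReal_coe]
      exact ⟨hf.strictMonoOn.monotoneOn x.2 (hsub ht) ht.1,
        hf.strictMonoOn.monotoneOn (hsub ht) y.2 ht.2⟩
    · rw [← onReal_coe, ← onReal_coe]
      exact intermediate_value_Icc hxy' (hf.contDiffOn.continuousOn.mono hsub)
  rw [intervalIntegral.integral_of_le hf', intervalIntegral.integral_of_le hxy',
    ← integral_Icc_eq_integral_Ioc, ← integral_Icc_eq_integral_Ioc, ← himage,
    integral_image_eq_integral_abs_deriv_smul measurableSet_Icc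
      (fun t ht => (hf.hasDerivWithinAt (hsub ht)).mono hsub) (hf.strictMonoOn.injOn.mono hsub)]
  refine setIntegral_congr_fun measurableSet_Icc fun t ht => ?_
  simp only [smul_eq_mul, abs_of_nonneg (hf.derivWithin_nonneg t)]

/-- By the change of variables `f`, the increment of `h ∘ f` is the integral of `f' r` against `ρ`.
It is compared with `c` times the increment of `h`, which is the integral of `ρ`. -/
lemma abs_conj_sub_le (hd : HasDensity h ρ) (hf : IsC1Diffeo f) (hr : ContinuousOn r (Icc 0 1))
    (hρ : ∀ x ∈ Icc (0 : ℝ) 1, ρ (onReal f x) = r x * ρ x) {x y : unitInterval} (hxy : x ≤ y)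
    {c ε : ℝ} (hc : ∀ t ∈ Icc (x : ℝ) y, |derivWithin (onReal f) (Icc 0 1) t * r t - c| ≤ ε) :
    |(h (f y) : ℝ) - h (f x) - c * (h y - h x)| ≤ ε * (h y - h x) := by
  have hxy' : (x : ℝ) ≤ y := hxy
  have hsub : Icc (x : ℝ) y ⊆ Icc 0 1 := Icc_subset_Icc x.2.1 y.2.2
  have hi := intervalIntegrable_of_mem hd.integrableOn x.2 y.2
  have hγ : ContinuousOn (fun t => derivWithin (onReal f) (Icc 0 1) t * r t) (uIcc (x : ℝ) y) := by
    rw [uIcc_of_le hxy']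
    exact (hf.continuousOn_derivWithin.mul hr).mono hsub
  rw [hd.sub_eq, hd.sub_eq, integral_comp_eq hf hxy,
    ← intervalIntegral.integral_const_mul, ← intervalIntegral.integral_const_mul,
    intervalIntegral.integral_congr
      (g := fun t => derivWithin (onReal f) (Icc 0 1) t * r t * ρ t) fun t ht => ?_,
    ← intervalIntegral.integral_sub (hi.continuousOn_mul hγ) (hi.const_mul c)]
  · refine (intervalIntegral.abs_integral_le_integral_abs hxy').trans
      (intervalIntegral.integral_mono_on hxy' ?_ (hi.const_mul ε) fun t ht => ?_)
    · exact ((hi.continuousOn_mul hγ).sub (hi.const_mul c)).abs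
    · rw [← sub_mul, abs_mul, abs_of_pos (hd.pos t)]
      exact mul_le_mul_of_nonneg_right (hc t ht) (hd.pos t).le
  · rw [uIcc_of_le hxy'] at ht
    simp only [hρ t (hsub ht), mul_assoc]

/-- Only the ratio `r` has to be continuous; neither continuity of `ρ` nor differentiability of `h`
is needed, because increments of `h ∘ f` are measured directly against increments of `h`. -/
theorem hasDerivWithinAt_conj (hd : HasDensity h ρ) (hmono : StrictMono h) (hf : IsC1Diffeo f)
    (hr : ContinuousOn r (Icc 0 1)) (hρ : ∀ x ∈ Icc (0 : ℝ) 1, ρ (onReal f x) = r x * ρ x)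
    (x : unitInterval) :
    HasDerivWithinAt (onReal (h * f * h⁻¹)) (derivOn f x * r x) (Icc 0 1) (h x) := by
  rw [hasDerivWithinAt_iff_isLittleO, Asymptotics.isLittleO_iff]
  intro ε hε
  obtain ⟨δ, hδ, hδ'⟩ := Metric.continuousWithinAt_iff.1
    ((hf.continuousOn_derivWithin.mul hr) x x.2) ε hε
  have hclose : ∀ᶠ z : unitInterval in 𝓝 x, |(z : ℝ) - x| < δ := by
    have := (continuous_subtype_val.tendsto x).eventually (Metric.ball_mem_nhds (x : ℝ) hδ)
    simpa [Real.dist_eq] using this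
  have hev : ∀ᶠ y : unitInterval in 𝓝 (h x), |((h.symm y : unitInterval) : ℝ) - x| < δ := by
    have : Tendsto h.symm (𝓝 (h x)) (𝓝 x) := by
      simpa using h.symm.continuous.tendsto (h x)
    exact this.eventually hclose
  have hev' : ∀ᶠ y in 𝓝[Icc (0 : ℝ) 1] (h x : ℝ), ∃ hy : y ∈ Icc (0 : ℝ) 1,
      |((h.symm ⟨y, hy⟩ : unitInterval) : ℝ) - x| < δ := by
    rw [nhdsWithin_eq_map_subtype_coe (h x).2, eventually_map]
    filter_upwards [hev] with y hy
    exact ⟨y.2, hy⟩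
  filter_upwards [hev'] with y ⟨hy, hyx⟩
  set z := h.symm ⟨y, hy⟩ with hz
  have hzy : h z = ⟨y, hy⟩ := h.apply_symm_apply _
  have e1 : onReal (h * f * h⁻¹) y = h (f z) := onReal_of_mem _ hy
  have e2 : onReal (h * f * h⁻¹) (h x) = h (f x) := by
    rw [onReal_coe]
    exact congrArg (fun w => ((h (f w) : unitInterval) : ℝ)) (h.symm_apply_apply x)
  have e3 : y = h z := by rw [hzy]
  rw [e1, e2, smul_eq_mul, Real.norm_eq_abs, Real.norm_eq_abs, e3]
  have key : ∀ t ∈ Icc (0 : ℝ) 1, |t - x| < δ →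
      |derivWithin (onReal f) (Icc 0 1) t * r t - derivOn f x * r x| ≤ ε := fun t ht htx => by
    have := hδ' ht htx
    rw [Real.dist_eq] at this
    exact this.le
  rw [abs_lt] at hyx
  rcases le_total x z with hxz | hxz
  · have h1 := abs_conj_sub_le hd hf hr hρ hxz (c := derivOn f x * r x) (ε := ε) fun t ht =>
      key t (Icc_subset_Icc x.2.1 z.2.2 ht) (abs_lt.2 ⟨by linarith [ht.1], by linarith [ht.2]⟩)
    have h2 : (h x : ℝ) ≤ h z := hmono.monotone hxz
    rw [abs_of_nonneg (sub_nonneg.2 h2)]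
    convert h1 using 2
    ring
  · have h1 := abs_conj_sub_le hd hf hr hρ hxz (c := derivOn f x * r x) (ε := ε) fun t ht =>
      key t (Icc_subset_Icc z.2.1 x.2.2 ht) (abs_lt.2 ⟨by linarith [ht.1], by linarith [ht.2]⟩)
    have h2 : (h z : ℝ) ≤ h x := hmono.monotone hxz
    rw [abs_sub_comm (h z : ℝ), abs_of_nonneg (sub_nonneg.2 h2), ← abs_neg]
    convert h1 using 2
    ring

lemma derivOn_conj (hd : HasDensity h ρ) (hmono : StrictMono h) (hf : IsC1Diffeo f)
    (hr : ContinuousOn r (Icc 0 1)) (hρ : ∀ x ∈ Icc (0 : ℝ) 1, ρ (onReal f x) = r x * ρ x)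
    (x : unitInterval) : derivOn (h * f * h⁻¹) (h x) = derivOn f x * r x :=
  (hasDerivWithinAt_conj hd hmono hf hr hρ x).derivWithin
    (uniqueDiffOn_Icc zero_lt_one _ (h x).2)

theorem contDiffOn_conj (hd : HasDensity h ρ) (hmono : StrictMono h) (hf : IsC1Diffeo f)
    (hr : ContinuousOn r (Icc 0 1)) (hρ : ∀ x ∈ Icc (0 : ℝ) 1, ρ (onReal f x) = r x * ρ x) :
    ContDiffOn ℝ 1 (onReal (h * f * h⁻¹)) (Icc 0 1) := by
  rw [contDiffOn_one_iff_derivWithin (uniqueDiffOn_Icc zero_lt_one)]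
  constructor
  · intro y hy
    have := hasDerivWithinAt_conj hd hmono hf hr hρ (h.symm ⟨y, hy⟩)
    rw [h.apply_symm_apply] at this
    exact this.differentiableWithinAt
  · rw [continuousOn_iff_continuous_domRestrict]
    have h1 : Continuous fun x : unitInterval => derivOn f x * r x :=
      continuousOn_iff_continuous_domRestrict.1 (hf.continuousOn_derivWithin.mul hr)
    refine (h1.comp h.symm.continuous).congr fun y => ?_
    have := derivOn_conj hd hmono hf hr hρ (h.symm y)
    rw [h.apply_symm_apply] at this
    exact this.symm

end C1

/-! ### The logarithmic weight and the singular density -/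

/-- The slowly varying weight `1 - η log d`. -/
noncomputable def logWeight (η d : ℝ) : ℝ := 1 - η * Real.log d

section logWeight

variable {η d d' C : ℝ}

lemma one_le_logWeight (hη : 0 ≤ η) (h0 : 0 ≤ d) (h1 : d ≤ 1) : 1 ≤ logWeight η d := by
  have := mul_nonneg hη (neg_nonneg.2 (Real.log_nonpos h0 h1))
  unfold logWeight
  linarith

lemma abs_logWeight_sub_le (hη : 0 ≤ η) (h : |Real.log d' - Real.log d| ≤ C) :
    |logWeight η d' - logWeight η d| ≤ η * C := by
  have : logWeight η d' - logWeight η d = -(η * (Real.log d' - Real.log d)) := by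
    unfold logWeight
    ring
  rw [this, abs_neg, abs_mul, abs_of_nonneg hη]
  exact mul_le_mul_of_nonneg_left h hη

/-- Slow variation: changing `d` by a bounded factor changes the weight by a bounded amount, which
is negligible against `logWeight η d` as `d` tends to `0`. -/
lemma abs_logWeight_div_sub_one_le (hη : 0 ≤ η) (h0 : 0 ≤ d) (h1 : d ≤ 1)
    (h : |Real.log d' - Real.log d| ≤ C) :
    |logWeight η d' / logWeight η d - 1| ≤ η * C / logWeight η d := by
  have hL := one_le_logWeight hη h0 h1
  have hL' : 0 < logWeight η d := by linarith
  rw [div_sub_one hL'.ne', abs_div, abs_of_pos hL']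
  exact div_le_div_of_nonneg_right (abs_logWeight_sub_le hη h) hL'.le

lemma abs_logWeight_div_sub_one_le' (hη : 0 ≤ η) (h0 : 0 ≤ d) (h1 : d ≤ 1)
    (h : |Real.log d' - Real.log d| ≤ C) :
    |logWeight η d' / logWeight η d - 1| ≤ η * C :=
  (abs_logWeight_div_sub_one_le hη h0 h1 h).trans
    (div_le_self (mul_nonneg hη ((abs_nonneg _).trans h)) (one_le_logWeight hη h0 h1))

lemma tendsto_logWeight (hη : 0 < η) : Tendsto (logWeight η) (𝓝[>] 0) atTop := by
  have h : Tendsto (fun d => η * -Real.log d) (𝓝[>] 0) atTop :=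
    (tendsto_neg_atBot_atTop.comp Real.tendsto_log_nhdsGT_zero).const_mul_atTop hη
  refine (tendsto_atTop_add_const_left _ 1 h).congr fun d => ?_
  unfold logWeight
  ring

lemma continuousAt_logWeight (hd : d ≠ 0) : ContinuousAt (logWeight η) d :=
  continuousAt_const.sub (continuousAt_const.mul (Real.continuousAt_log hd))

lemma measurable_logWeight : Measurable (logWeight η) :=
  measurable_const.sub (Real.measurable_log.const_mul _)

end logWeight

lemma lintegral_neg_log_le {L : ℝ} (h0 : 0 < L) (h1 : L ≤ 1) :
    ∫⁻ x in Ioo 0 L, ENNReal.ofReal (-Real.log x) ≤ 1 := by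
  have hint : IntegrableOn (fun x => -Real.log x) (Ioo 0 L) :=
    ((intervalIntegrable_iff_integrableOn_Ioo_of_le h0.le).1
      intervalIntegral.intervalIntegrable_log').neg
  rw [← ofReal_integral_eq_lintegral_ofReal hint
    ((ae_restrict_iff' measurableSet_Ioo).2 (.of_forall fun x hx =>
      neg_nonneg.2 (Real.log_nonpos hx.1.le (hx.2.le.trans h1)))), ENNReal.ofReal_le_one,
    ← integral_Ioc_eq_integral_Ioo, ← intervalIntegral.integral_of_le h0.le,
    intervalIntegral.integral_neg, integral_log]
  -- The integral equals `L - L log L`, and `L log L ≥ L - 1`.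
  have h2 := Real.one_sub_inv_le_log_of_pos h0
  have h3 : L * (1 - L⁻¹) ≤ L * Real.log L := mul_le_mul_of_nonneg_left h2 h0.le
  rw [mul_sub, mul_inv_cancel₀ h0.ne'] at h3
  linarith

/-- The density whose primitive is a homeomorphism of `[0,1]` that is singular at both ends of the
component `(a,b)` of the complement of `P`, and affine on all the other components. -/
noncomputable def gapDensity (P : Set ℝ) (u : ℝ → ℝ) (a b η x : ℝ) : ℝ :=
  open Classical in
  if x ∈ Ioo a b then logWeight η (x - a) / logWeight η (b - x) else slopeAt u (gapLength P x)

section gapDensity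

variable {P : Set ℝ} {u : ℝ → ℝ} {a b η : ℝ}

lemma gapDensity_of_mem {x : ℝ} (hx : x ∈ Ioo a b) :
    gapDensity P u a b η x = logWeight η (x - a) / logWeight η (b - x) := if_pos hx

lemma gapDensity_of_not_mem {x : ℝ} (hx : x ∉ Ioo a b) :
    gapDensity P u a b η x = slopeAt u (gapLength P x) := if_neg hx

lemma one_le_logWeight_left (ha : 0 ≤ a) (hb : b ≤ 1) (hη : 0 ≤ η) {x : ℝ} (hx : x ∈ Ioo a b) :
    1 ≤ logWeight η (x - a) :=
  one_le_logWeight hη (by linarith [hx.1]) (by linarith [hx.2])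

lemma one_le_logWeight_right (ha : 0 ≤ a) (hb : b ≤ 1) (hη : 0 ≤ η) {x : ℝ} (hx : x ∈ Ioo a b) :
    1 ≤ logWeight η (b - x) :=
  one_le_logWeight hη (by linarith [hx.2]) (by linarith [hx.1])

lemma gapDensity_pos (hP : IsGapSet P) (hu : ∀ s, 0 < s → 0 < u s) (ha : 0 ≤ a) (hb : b ≤ 1)
    (hη : 0 ≤ η) (x : ℝ) : 0 < gapDensity P u a b η x := by
  by_cases hx : x ∈ Ioo a b
  · rw [gapDensity_of_mem hx]
    have := one_le_logWeight_left ha hb hη hx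
    have := one_le_logWeight_right ha hb hη hx
    exact div_pos (by linarith) (by linarith)
  · rw [gapDensity_of_not_mem hx]
    exact slopeAt_pos hu (hP.gapLength_nonneg x)

lemma measurable_gapDensity (hP : IsGapSet P) (hu : Measurable u) :
    Measurable (gapDensity P u a b η) := by
  classical
  exact Measurable.ite measurableSet_Ioo
    ((measurable_logWeight.comp (measurable_id.sub_const a)).div
      (measurable_logWeight.comp (measurable_id.const_sub b)))
    ((measurable_slopeAt hu).comp hP.measurable_gapLength)

lemma enorm_logWeight_div_sub_one_le (ha : 0 ≤ a) (hb : b ≤ 1) (hη : 0 ≤ η) {x : ℝ}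
    (hx : x ∈ Ioo a b) :
    ‖logWeight η (x - a) / logWeight η (b - x) - 1‖ₑ ≤
      ENNReal.ofReal η * (ENNReal.ofReal (-Real.log (x - a)) +
        ENNReal.ofReal (-Real.log (b - x))) := by
  have h1 := one_le_logWeight_left ha hb hη hx
  have h2 := one_le_logWeight_right ha hb hη hx
  have h3 : 0 ≤ -Real.log (x - a) :=
    neg_nonneg.2 (Real.log_nonpos (by linarith [hx.1]) (by linarith [hx.2]))
  have h4 : 0 ≤ -Real.log (b - x) :=
    neg_nonneg.2 (Real.log_nonpos (by linarith [hx.2]) (by linarith [hx.1]))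
  rw [← ENNReal.ofReal_add h3 h4, ← ENNReal.ofReal_mul hη, Real.enorm_eq_ofReal_abs]
  refine ENNReal.ofReal_le_ofReal ?_
  have hpos : 0 < logWeight η (b - x) := by linarith
  rw [div_sub_one hpos.ne', abs_div, abs_of_pos hpos]
  refine (div_le_self (abs_nonneg _) h2).trans ?_
  have h5 := mul_nonneg hη h3
  have h6 := mul_nonneg hη h4
  unfold logWeight
  rw [abs_le]
  constructor <;> nlinarith

/-- Inside `(a, b)` the deviation from `1` is at most `η` times the sum of two logarithmic
singularities, each with integral at most `1`; hence the term `2 * η`. -/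
lemma lintegral_gapDensity_sub_one_le (hP : IsGapSet P) (hu : Measurable u) (ha : 0 ≤ a)
    (hab : a < b) (hb : b ≤ 1) (hη : 0 ≤ η) {δ : ℝ} (hδ : 0 ≤ δ)
    (hint : ∫⁻ x in Icc 0 1, ‖slopeAt u (gapLength P x) - 1‖ₑ ≤ ENNReal.ofReal δ) :
    ∫⁻ x in Icc 0 1, ‖gapDensity P u a b η x - 1‖ₑ ≤ ENNReal.ofReal (δ + 2 * η) := by
  have hm1 : Measurable fun x => ENNReal.ofReal (-Real.log (x - a)) :=
    (Real.measurable_log.comp (measurable_id.sub_const a)).neg.ennreal_ofReal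
  have hm2 : Measurable fun x => ENNReal.ofReal (-Real.log (b - x)) :=
    (Real.measurable_log.comp (measurable_id.const_sub b)).neg.ennreal_ofReal
  have e1 : ∫⁻ x in Ioo a b, ENNReal.ofReal (-Real.log (x - a)) ≤ 1 := by
    have h := (measurePreserving_sub_right volume a).setLIntegral_comp_preimage_emb
      (MeasurableEquiv.subRight a).measurableEmbedding
      (fun x => ENNReal.ofReal (-Real.log x)) (Ioo 0 (b - a))
    rw [preimage_sub_const_Ioo, zero_add, sub_add_cancel] at h
    rw [h]
    exact lintegral_neg_log_le (by linarith) (by linarith)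
  have e2 : ∫⁻ x in Ioo a b, ENNReal.ofReal (-Real.log (b - x)) ≤ 1 := by
    have h := (Measure.measurePreserving_sub_left volume b).setLIntegral_comp_preimage_emb
      (MeasurableEquiv.subLeft b).measurableEmbedding
      (fun x => ENNReal.ofReal (-Real.log x)) (Ioo 0 (b - a))
    rw [preimage_const_sub_Ioo, sub_zero, sub_sub_cancel] at h
    rw [h]
    exact lintegral_neg_log_le (by linarith) (by linarith)
  calc ∫⁻ x in Icc 0 1, ‖gapDensity P u a b η x - 1‖ₑ
      ≤ ∫⁻ x in Icc 0 1, (‖slopeAt u (gapLength P x) - 1‖ₑ +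
          (Ioo a b).indicator (fun x => ENNReal.ofReal η * (ENNReal.ofReal (-Real.log (x - a)) +
            ENNReal.ofReal (-Real.log (b - x)))) x) := by
        refine lintegral_mono fun x => ?_
        by_cases hx : x ∈ Ioo a b
        · rw [gapDensity_of_mem hx, indicator_of_mem hx]
          exact (enorm_logWeight_div_sub_one_le ha hb hη hx).trans le_add_self
        · rw [gapDensity_of_not_mem hx]
          exact le_self_add
    _ = (∫⁻ x in Icc 0 1, ‖slopeAt u (gapLength P x) - 1‖ₑ) +
          ∫⁻ x in Icc 0 1, (Ioo a b).indicator (fun x => ENNReal.ofReal η *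
            (ENNReal.ofReal (-Real.log (x - a)) + ENNReal.ofReal (-Real.log (b - x)))) x :=
        lintegral_add_left (((measurable_slopeAt hu).comp
          hP.measurable_gapLength).sub_const 1).enorm _
    _ ≤ ENNReal.ofReal δ + ENNReal.ofReal η * (1 + 1) := by
        refine add_le_add hint ?_
        refine (setLIntegral_le_lintegral _ _).trans ?_
        rw [lintegral_indicator measurableSet_Ioo, lintegral_const_mul' _ _ ENNReal.ofReal_ne_top,
          lintegral_add_left hm1]
        gcongr
    _ = ENNReal.ofReal (δ + 2 * η) := by
        rw [ENNReal.ofReal_add hδ (by positivity), mul_comm 2 η, ENNReal.ofReal_mul hη,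
          one_add_one_eq_two]
        simp

lemma integrableOn_gapDensity (hP : IsGapSet P) (hu : Measurable u) {C : ℝ}
    (hint : ∫⁻ x in Icc 0 1, ‖gapDensity P u a b η x - 1‖ₑ ≤ ENNReal.ofReal C) :
    IntegrableOn (gapDensity P u a b η) (Icc 0 1) := by
  have h : IntegrableOn (fun x => gapDensity P u a b η x - 1) (Icc 0 1) :=
    ⟨((measurable_gapDensity hP hu).sub_const 1).aestronglyMeasurable,
      hint.trans_lt ENNReal.ofReal_lt_top⟩
  have h1 : IntegrableOn (fun _ => (1 : ℝ)) (Icc (0 : ℝ) 1) := by simp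
  refine (h.add h1).congr (.of_forall fun x => ?_)
  simp

/-- The multiplicative cocycle `ρ ∘ F / ρ` of the density. -/
noncomputable def gapRatio (P : Set ℝ) (u : ℝ → ℝ) (a b η : ℝ) (F : ℝ → ℝ) (x : ℝ) : ℝ :=
  gapDensity P u a b η (F x) / gapDensity P u a b η x

variable {F : ℝ → ℝ} {C : ℝ}

lemma map_mem_Ioo_iff (ha : 0 ≤ a) (hab : a < b) (hb : b ≤ 1) (hF : StrictMonoOn F (Icc 0 1))
    (hFa : F a = a) (hFb : F b = b) {x : ℝ} (hx : x ∈ Icc (0 : ℝ) 1) :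
    F x ∈ Ioo a b ↔ x ∈ Ioo a b := by
  have haI : a ∈ Icc (0 : ℝ) 1 := ⟨ha, by linarith⟩
  have hbI : b ∈ Icc (0 : ℝ) 1 := ⟨by linarith, hb⟩
  rw [mem_Ioo, mem_Ioo, ← hF.lt_iff_lt haI hx, ← hF.lt_iff_lt hx hbI, hFa, hFb]

lemma gapRatio_of_not_mem (hP : IsGapSet P) (hu : ∀ s, 0 < s → 0 < u s) (ha : 0 ≤ a) (hab : a < b)
    (hb : b ≤ 1) (hη : 0 ≤ η) (hF : StrictMonoOn F (Icc 0 1))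
    (hfix : ∀ x ∈ Icc (0 : ℝ) 1, x ∈ P → F x = x) (hFa : F a = a) (hFb : F b = b)
    {x : ℝ} (hx : x ∈ Icc (0 : ℝ) 1) (hx' : x ∉ Ioo a b) : gapRatio P u a b η F x = 1 := by
  have h := gapDensity_pos (a := a) (b := b) hP hu ha hb hη x
  rw [gapRatio, div_eq_one_iff_eq h.ne', gapDensity_of_not_mem hx',
    gapDensity_of_not_mem (fun h => hx' ((map_mem_Ioo_iff ha hab hb hF hFa hFb hx).1 h)),
    hP.gapLength_map hF hfix hx]

lemma gapRatio_of_mem (ha : 0 ≤ a) (hab : a < b) (hb : b ≤ 1)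
    (hF : StrictMonoOn F (Icc 0 1)) (hFa : F a = a) (hFb : F b = b)
    {x : ℝ} (hx : x ∈ Ioo a b) : gapRatio P u a b η F x =
      logWeight η (F x - a) / logWeight η (x - a) *
        (logWeight η (b - F x) / logWeight η (b - x))⁻¹ := by
  have hxI : x ∈ Icc (0 : ℝ) 1 := ⟨by linarith [hx.1], by linarith [hx.2]⟩
  rw [gapRatio, gapDensity_of_mem hx,
    gapDensity_of_mem ((map_mem_Ioo_iff ha hab hb hF hFa hFb hxI).2 hx), inv_div,
    div_div_div_eq, div_mul_div_comm]
  ring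

/-- The only delicate points are `a` and `b`. At each of them the weight of the vanishing distance
has ratio tending to `1` by slow variation, and the other weight is continuous and positive there;
outside `(a, b)` the ratio is identically `1`. -/
lemma continuousOn_gapRatio (hP : IsGapSet P) (hu : ∀ s, 0 < s → 0 < u s) (ha : 0 ≤ a)
    (hab : a < b) (hb : b ≤ 1) (hη : 0 < η) (hF : StrictMonoOn F (Icc 0 1))
    (hFc : ContinuousOn F (Icc 0 1))
    (hfix : ∀ x ∈ Icc (0 : ℝ) 1, x ∈ P → F x = x) (hFa : F a = a) (hFb : F b = b)
    (hCa : ∀ x ∈ Ioo a b, |Real.log (F x - a) - Real.log (x - a)| ≤ C)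
    (hCb : ∀ x ∈ Ioo a b, |Real.log (b - F x) - Real.log (b - x)| ≤ C) :
    ContinuousOn (gapRatio P u a b η F) (Icc 0 1) := by
  have haI : a ∈ Icc (0 : ℝ) 1 := ⟨ha, by linarith⟩
  have hbI : b ∈ Icc (0 : ℝ) 1 := ⟨by linarith, hb⟩
  have hone : ∀ x ∈ Icc (0 : ℝ) 1, x ∉ Ioo a b → gapRatio P u a b η F x = 1 :=
    fun x hx hx' => gapRatio_of_not_mem hP hu ha hab hb hη.le hF hfix hFa hFb hx hx'
  have hlim : ∀ {d : ℝ → ℝ} {l : Filter ℝ}, Tendsto d l (𝓝[>] 0) →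
      Tendsto (fun x => η * C / logWeight η (d x)) l (𝓝 0) := fun hd =>
    ((tendsto_logWeight hη).comp hd).const_div_atTop _
  have hA : Tendsto (gapRatio P u a b η F) (𝓝[>] a) (𝓝 1) := by
    have hd : Tendsto (fun x => x - a) (𝓝[>] a) (𝓝[>] 0) := by
      refine tendsto_nhdsWithin_iff.2 ⟨?_, eventually_mem_nhdsWithin.mono fun x hx =>
        mem_Ioi.2 (sub_pos.2 hx)⟩
      have : Tendsto (fun x => x - a) (𝓝 a) (𝓝 (a - a)) := tendsto_id.sub_const a
      rw [sub_self] at this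
      exact this.mono_left nhdsWithin_le_nhds
    have h1 : Tendsto (fun x => logWeight η (F x - a) / logWeight η (x - a)) (𝓝[>] a) (𝓝 1) := by
      rw [tendsto_iff_dist_tendsto_zero]
      refine squeeze_zero' (.of_forall fun _ => dist_nonneg) ?_ (hlim hd)
      filter_upwards [Ioo_mem_nhdsGT hab] with x hx
      exact abs_logWeight_div_sub_one_le hη.le (by linarith [hx.1]) (by linarith [hx.2]) (hCa x hx)
    have hFlim : Tendsto F (𝓝[>] a) (𝓝 a) := by
      have := (hFc a haI).mono_left (nhdsWithin_le_of_mem (show Icc (0 : ℝ) 1 ∈ 𝓝[>] a from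
        mem_of_superset (Ioo_mem_nhdsGT hab) fun x hx =>
          ⟨by linarith [hx.1], by linarith [hx.2]⟩))
      rwa [hFa] at this
    have hL := continuousAt_logWeight (η := η) (sub_pos.2 hab).ne'
    have hLpos := one_le_logWeight hη.le (sub_pos.2 hab).le (by linarith : b - a ≤ 1)
    have h2 : Tendsto (fun x => (logWeight η (b - F x) / logWeight η (b - x))⁻¹) (𝓝[>] a)
        (𝓝 1) := by
      have := ((hL.tendsto.comp (hFlim.const_sub b)).div
        (hL.tendsto.comp ((tendsto_nhdsWithin_of_tendsto_nhds tendsto_id).const_sub b))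
        (by linarith)).inv₀ (div_pos (by linarith) (by linarith)).ne'
      rw [div_self (by linarith), inv_one] at this
      exact this
    have h3 := h1.mul h2
    rw [one_mul] at h3
    refine h3.congr' ?_
    filter_upwards [Ioo_mem_nhdsGT hab] with x hx
    exact (gapRatio_of_mem ha hab hb hF hFa hFb hx).symm
  have hB : Tendsto (gapRatio P u a b η F) (𝓝[<] b) (𝓝 1) := by
    have hd : Tendsto (fun x => b - x) (𝓝[<] b) (𝓝[>] 0) := by
      refine tendsto_nhdsWithin_iff.2 ⟨?_, eventually_mem_nhdsWithin.mono fun x hx =>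
        mem_Ioi.2 (sub_pos.2 hx)⟩
      have : Tendsto (fun x => b - x) (𝓝 b) (𝓝 (b - b)) := tendsto_id.const_sub b
      rw [sub_self] at this
      exact this.mono_left nhdsWithin_le_nhds
    have h1 : Tendsto (fun x => logWeight η (b - F x) / logWeight η (b - x)) (𝓝[<] b) (𝓝 1) := by
      rw [tendsto_iff_dist_tendsto_zero]
      refine squeeze_zero' (.of_forall fun _ => dist_nonneg) ?_ (hlim hd)
      filter_upwards [Ioo_mem_nhdsLT hab] with x hx
      exact abs_logWeight_div_sub_one_le hη.le (by linarith [hx.2]) (by linarith [hx.1]) (hCb x hx)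
    have hFlim : Tendsto F (𝓝[<] b) (𝓝 b) := by
      have := (hFc b hbI).mono_left (nhdsWithin_le_of_mem (show Icc (0 : ℝ) 1 ∈ 𝓝[<] b from
        mem_of_superset (Ioo_mem_nhdsLT hab) fun x hx =>
          ⟨by linarith [hx.1], by linarith [hx.2]⟩))
      rwa [hFb] at this
    have hL := continuousAt_logWeight (η := η) (sub_pos.2 hab).ne'
    have hLpos := one_le_logWeight hη.le (sub_pos.2 hab).le (by linarith : b - a ≤ 1)
    have h2 : Tendsto (fun x => logWeight η (F x - a) / logWeight η (x - a)) (𝓝[<] b) (𝓝 1) := by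
      have := (hL.tendsto.comp (hFlim.sub_const a)).div
        (hL.tendsto.comp ((tendsto_nhdsWithin_of_tendsto_nhds tendsto_id).sub_const a))
        (by linarith)
      rw [div_self (by linarith)] at this
      exact this
    have h3 := h2.mul (h1.inv₀ one_ne_zero)
    rw [inv_one, one_mul] at h3
    refine h3.congr' ?_
    filter_upwards [Ioo_mem_nhdsLT hab] with x hx
    exact (gapRatio_of_mem ha hab hb hF hFa hFb hx).symm
  intro x hx
  have hxa : x < a ∨ x = a ∨ x ∈ Ioo a b ∨ x = b ∨ b < x := by
    rcases lt_trichotomy x a with h | h | h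
    · exact .inl h
    · exact .inr (.inl h)
    rcases lt_trichotomy x b with h' | h' | h'
    · exact .inr (.inr (.inl ⟨h, h'⟩))
    · exact .inr (.inr (.inr (.inl h')))
    · exact .inr (.inr (.inr (.inr h')))
  have hout : ∀ s ∈ 𝓝 x, (∀ y ∈ s, y ∉ Ioo a b) →
      ContinuousWithinAt (gapRatio P u a b η F) (Icc 0 1) x := fun s hs hs' => by
    refine (continuousWithinAt_const (b := (1 : ℝ))).congr_of_eventuallyEq ?_
      (hone x hx (hs' x (mem_of_mem_nhds hs)))
    filter_upwards [mem_nhdsWithin_of_mem_nhds hs, self_mem_nhdsWithin] with y hy hyI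
    exact hone y hyI (hs' y hy)
  rcases hxa with h | rfl | h | rfl | h
  · exact hout _ (Iio_mem_nhds h) fun y hy hy' => absurd hy'.1 (not_lt.2 (le_of_lt hy))
  · rw [ContinuousWithinAt, hone x hx fun h => lt_irrefl _ h.1]
    intro U hU
    rw [Filter.mem_map]
    have h1 := eventually_nhdsWithin_iff.1 (hA.eventually hU)
    filter_upwards [mem_nhdsWithin_of_mem_nhds h1, self_mem_nhdsWithin] with y hy hyI
    by_cases hya : x < y
    · exact hy hya
    · show gapRatio P u x b η F y ∈ U
      rw [hone y hyI fun h => hya h.1]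
      exact mem_of_mem_nhds hU
  · have hI : Ioo a b ∈ 𝓝 x := Ioo_mem_nhds h.1 h.2
    have hFx := (map_mem_Ioo_iff ha hab hb hF hFa hFb hx).2 h
    have hFcx : ContinuousAt F x := hFc.continuousAt (mem_of_superset hI fun y hy =>
      ⟨by linarith [hy.1], by linarith [hy.2]⟩)
    have h1 : ContinuousAt (fun y => logWeight η (F y - a)) x :=
      (continuousAt_logWeight (sub_pos.2 hFx.1).ne').comp (f := fun y => F y - a)
        (hFcx.sub continuousAt_const)
    have h2 : ContinuousAt (fun y => logWeight η (y - a)) x :=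
      (continuousAt_logWeight (sub_pos.2 h.1).ne').comp (f := fun y => y - a)
        (continuousAt_id.sub continuousAt_const)
    have h3 : ContinuousAt (fun y => logWeight η (b - F y)) x :=
      (continuousAt_logWeight (sub_pos.2 hFx.2).ne').comp (f := fun y => b - F y)
        (continuousAt_const.sub hFcx)
    have h4 : ContinuousAt (fun y => logWeight η (b - y)) x :=
      (continuousAt_logWeight (sub_pos.2 h.2).ne').comp (f := fun y => b - y)
        (continuousAt_const.sub continuousAt_id)
    have p2 := one_le_logWeight_left ha hb hη.le h
    have p3 := one_le_logWeight_right ha hb hη.le hFx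
    have p4 := one_le_logWeight_right ha hb hη.le h
    refine ContinuousAt.continuousWithinAt (((h1.div h2 (by linarith)).mul
      ((h3.div h4 (by linarith)).inv₀ (div_pos (by linarith) (by linarith)).ne')).congr ?_)
    filter_upwards [hI] with y hy
    exact (gapRatio_of_mem ha hab hb hF hFa hFb hy).symm
  · rw [ContinuousWithinAt, hone x hx fun h => lt_irrefl _ h.2]
    intro U hU
    rw [Filter.mem_map]
    have h1 := eventually_nhdsWithin_iff.1 (hB.eventually hU)
    filter_upwards [mem_nhdsWithin_of_mem_nhds h1, self_mem_nhdsWithin] with y hy hyI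
    by_cases hya : y < x
    · exact hy hya
    · show gapRatio P u a x η F y ∈ U
      rw [hone y hyI fun h => hya h.2]
      exact mem_of_mem_nhds hU
  · exact hout _ (Ioi_mem_nhds h) fun y hy hy' => absurd hy'.2 (not_lt.2 (le_of_lt hy))

lemma abs_gapRatio_sub_one_le (hP : IsGapSet P) (hu : ∀ s, 0 < s → 0 < u s) (ha : 0 ≤ a)
    (hab : a < b) (hb : b ≤ 1) (hη : 0 ≤ η) (hF : StrictMonoOn F (Icc 0 1))
    (hfix : ∀ x ∈ Icc (0 : ℝ) 1, x ∈ P → F x = x) (hFa : F a = a) (hFb : F b = b) (hC : 0 ≤ C)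
    (hCa : ∀ x ∈ Ioo a b, |Real.log (F x - a) - Real.log (x - a)| ≤ C)
    (hCb : ∀ x ∈ Ioo a b, |Real.log (b - F x) - Real.log (b - x)| ≤ C) {x : ℝ}
    (hx : x ∈ Icc (0 : ℝ) 1) :
    |gapRatio P u a b η F x - 1| ≤ η * C * (2 + η * C) := by
  have hηC : 0 ≤ η * C := mul_nonneg hη hC
  by_cases h : x ∈ Ioo a b
  · have hFx := (map_mem_Ioo_iff ha hab hb hF hFa hFb hx).2 h
    rw [gapRatio_of_mem ha hab hb hF hFa hFb h, inv_div]
    have h1 := abs_logWeight_div_sub_one_le' hη (by linarith [h.1]) (by linarith [h.2]) (hCa x h)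
    -- This ratio is inverted, so the estimate is applied with the two distances exchanged.
    have h2 := abs_logWeight_div_sub_one_le' hη (by linarith [hFx.2] : 0 ≤ b - F x)
      (by linarith [hFx.1]) ((abs_sub_comm _ _).trans_le (hCb x h))
    set A := logWeight η (F x - a) / logWeight η (x - a)
    set B := logWeight η (b - x) / logWeight η (b - F x)
    calc |A * B - 1| = |(A - 1) * (B - 1) + (A - 1) + (B - 1)| := by ring_nf
      _ ≤ |A - 1| * |B - 1| + |A - 1| + |B - 1| := by
          rw [← abs_mul]
          exact (abs_add_le _ _).trans (by gcongr; exact abs_add_le _ _)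
      _ ≤ η * C * (η * C) + η * C + η * C := by gcongr
      _ = η * C * (2 + η * C) := by ring
  · rw [gapRatio_of_not_mem hP hu ha hab hb hη hF hfix hFa hFb hx h]
    simpa using by positivity

end gapDensity

/-! ### Distortion of diffeomorphisms and displacement of the primitive -/

section Lipschitz

variable {f h : unitInterval ≃ₜ unitInterval}

lemma exists_abs_sub_le_of_contDiffOn (hf : ContDiffOn ℝ 1 (onReal f) (Icc 0 1)) :
    ∃ K : ℝ, 1 ≤ K ∧ ∀ x y : unitInterval, |(f x : ℝ) - f y| ≤ K * |(x : ℝ) - y| := by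
  obtain ⟨K, hK⟩ := isCompact_Icc.exists_bound_of_continuousOn
    (hf.continuousOn_derivWithin (uniqueDiffOn_Icc zero_lt_one) le_rfl)
  refine ⟨max K 1, le_max_right _ _, fun x y => ?_⟩
  have := (convex_Icc (0 : ℝ) 1).norm_image_sub_le_of_norm_derivWithin_le
    (hf.differentiableOn one_ne_zero) hK y.2 x.2
  rw [onReal_coe, onReal_coe, Real.norm_eq_abs, Real.norm_eq_abs] at this
  exact this.trans (mul_le_mul_of_nonneg_right (le_max_left _ _) (abs_nonneg _))

namespace IsC1Diffeo

lemma exists_abs_sub_le (hf : IsC1Diffeo f) :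
    ∃ K : ℝ, 1 ≤ K ∧ (∀ x y : unitInterval, |(f x : ℝ) - f y| ≤ K * |(x : ℝ) - y|) ∧
      ∀ x y : unitInterval, |(x : ℝ) - y| ≤ K * |(f x : ℝ) - f y| := by
  obtain ⟨K, hK1, hK⟩ := exists_abs_sub_le_of_contDiffOn hf.contDiffOn
  obtain ⟨L, hL1, hL⟩ := exists_abs_sub_le_of_contDiffOn hf.contDiffOn_symm
  refine ⟨max K L, hK1.trans (le_max_left _ _), fun x y => (hK x y).trans ?_, fun x y => ?_⟩
  · exact mul_le_mul_of_nonneg_right (le_max_left _ _) (abs_nonneg _)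
  · have := hL (f x) (f y)
    rw [f.symm_apply_apply, f.symm_apply_apply] at this
    exact this.trans (mul_le_mul_of_nonneg_right (le_max_right _ _) (abs_nonneg _))

/-- This is the bi-Lipschitz property in logarithmic form. The order of `x` and `y` is irrelevant
because `Real.log` depends only on the absolute value. -/
lemma exists_abs_log_sub_le (hf : IsC1Diffeo f) :
    ∃ C : ℝ, 0 ≤ C ∧ ∀ x y : unitInterval, x ≠ y →
      |Real.log ((f x : ℝ) - f y) - Real.log ((x : ℝ) - y)| ≤ C := by
  obtain ⟨K, hK1, hK, hK'⟩ := hf.exists_abs_sub_le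
  refine ⟨Real.log K, Real.log_nonneg hK1, fun x y hxy => ?_⟩
  have h1 : 0 < |(x : ℝ) - y| := abs_pos.2 (sub_ne_zero.2 fun h => hxy (Subtype.ext h))
  have h2 : 0 < |(f x : ℝ) - f y| :=
    abs_pos.2 (sub_ne_zero.2 fun h => hxy (f.injective (Subtype.ext h)))
  have h3 := Real.log_le_log h2 (hK x y)
  have h4 := Real.log_le_log h1 (hK' x y)
  rw [Real.log_mul (by positivity) h1.ne', Real.log_abs, Real.log_abs] at h3
  rw [Real.log_mul (by positivity) h2.ne', Real.log_abs, Real.log_abs] at h4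
  rw [abs_le]
  constructor <;> linarith

end IsC1Diffeo

lemma StrictMono.homeomorph_zero (hf : StrictMono f) : f 0 = 0 :=
  le_antisymm (by
    have := hf.monotone (unitInterval.nonneg' (t := f.symm 0))
    rwa [f.apply_symm_apply] at this) unitInterval.nonneg'

lemma StrictMono.homeomorph_one (hf : StrictMono f) : f 1 = 1 :=
  le_antisymm unitInterval.le_one' (by
    have := hf.monotone (unitInterval.le_one' (t := f.symm 1))
    rwa [f.apply_symm_apply] at this)

lemma abs_density_sub_le {ρ : ℝ → ℝ} (hpos : ∀ x, 0 < ρ x) (hint : IntegrableOn ρ (Icc 0 1))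
    (hmono : StrictMono h) (hd : HasDensity h fun x => (∫ t in (0 : ℝ)..1, ρ t)⁻¹ * ρ x) {C : ℝ}
    (hC0 : 0 ≤ C) (hC : ∫⁻ x in Icc 0 1, ‖ρ x - 1‖ₑ ≤ ENNReal.ofReal C) (x : unitInterval) :
    |(h x : ℝ) - x| ≤ 2 * C := by
  have hint' : IntegrableOn (fun t => ρ t - 1) (Icc 0 1) := hint.sub (by simp)
  have hone : ∀ y ∈ Icc (0 : ℝ) 1, |(∫ t in (0 : ℝ)..y, ρ t) - y| ≤ C := fun y hy => by
    have h0 : (0 : ℝ) ∈ Icc (0 : ℝ) 1 := by simp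
    have e : (∫ t in (0 : ℝ)..y, ρ t) - y = ∫ t in (0 : ℝ)..y, (ρ t - 1) := by
      rw [intervalIntegral.integral_sub (intervalIntegrable_of_mem hint h0 hy) (by simp)]
      simp
    rw [e]
    refine (intervalIntegral.abs_integral_le_integral_abs hy.1).trans ?_
    rw [intervalIntegral.integral_of_le hy.1]
    refine (setIntegral_mono_set hint'.abs (.of_forall fun _ => abs_nonneg _)
      (LE.le.eventuallyLE (Ioc_subset_Icc_self.trans
        (Icc_subset_Icc_right hy.2)))).trans ?_
    rw [← ENNReal.ofReal_le_ofReal_iff hC0]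
    refine le_trans (le_of_eq ?_) hC
    rw [ofReal_integral_eq_lintegral_ofReal hint'.abs (.of_forall fun _ => abs_nonneg _)]
    simp only [Real.enorm_eq_ofReal_abs]
  set M := ∫ t in (0 : ℝ)..1, ρ t with hM
  have hMpos : 0 < M := integral_pos_of_lt hpos hint (by simp) (by simp) one_pos
  have hx : (h x : ℝ) = M⁻¹ * ∫ t in (0 : ℝ)..x, ρ t := by
    have := hd.sub_eq 0 x
    rw [hmono.homeomorph_zero, intervalIntegral.integral_const_mul] at this
    simpa using this
  have h1 := hone x x.2
  have h2 := hone 1 (by simp)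
  rw [← hM] at h2
  set A := ∫ t in (0 : ℝ)..x, ρ t
  have h3 : A = M * h x := by rw [hx]; field_simp
  -- Both the partial integral `A` and the total mass `M` deviate by at most `C` from the values for
  -- the density `1`; this gives the factor `2`.
  have h4 : (h x : ℝ) - x = (A - x) - h x * (M - 1) := by rw [h3]; ring
  rw [h4]
  have h5 : |(h x : ℝ) * (M - 1)| ≤ C := by
    rw [abs_mul, abs_of_nonneg (h x).2.1]
    exact (mul_le_of_le_one_left (abs_nonneg _) (h x).2.2).trans h2
  calc _ ≤ |A - x| + |(h x : ℝ) * (M - 1)| := abs_sub _ _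
    _ ≤ 2 * C := by linarith

end Lipschitz

/-! ### The conjugated diffeomorphisms -/

section Conjugation

variable {f h : unitInterval ≃ₜ unitInterval} {P : Set ℝ} {u : ℝ → ℝ} {a b : unitInterval}
  {η c : ℝ}

lemma exists_abs_log_endpoints_le (hf : IsC1Diffeo f) (hfa : f a = a) (hfb : f b = b) :
    ∃ C : ℝ, 0 ≤ C ∧
      (∀ x ∈ Ioo (a : ℝ) b, |Real.log (onReal f x - a) - Real.log (x - a)| ≤ C) ∧
      ∀ x ∈ Ioo (a : ℝ) b, |Real.log (b - onReal f x) - Real.log (b - x)| ≤ C := by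
  obtain ⟨C, hC0, hC⟩ := hf.exists_abs_log_sub_le
  refine ⟨C, hC0, fun x hx => ?_, fun x hx => ?_⟩
  all_goals
    have hxI : x ∈ Icc (0 : ℝ) 1 := ⟨a.2.1.trans hx.1.le, hx.2.le.trans b.2.2⟩
    rw [onReal_of_mem f hxI]
  · have := hC ⟨x, hxI⟩ a fun h => hx.1.ne' (congrArg Subtype.val h)
    rwa [hfa] at this
  · have := hC b ⟨x, hxI⟩ fun h => hx.2.ne' (congrArg Subtype.val h)
    rwa [hfb] at this

lemma onReal_eq_self (hfix : ∀ x : unitInterval, (x : ℝ) ∈ P → f x = x) (x : ℝ)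
    (hx : x ∈ Icc (0 : ℝ) 1) (hxP : x ∈ P) : onReal f x = x := by
  rw [onReal_of_mem f hx, hfix ⟨x, hx⟩ hxP]

lemma gapDensity_onReal (hP : IsGapSet P) (hu : ∀ s, 0 < s → 0 < u s) (hη : 0 < η) (x : ℝ) :
    c * gapDensity P u a b η (onReal f x) =
      gapRatio P u a b η (onReal f) x * (c * gapDensity P u a b η x) := by
  have := gapDensity_pos (a := a) (b := b) hP hu a.2.1 b.2.2 hη.le x
  rw [gapRatio]
  field_simp

lemma continuousOn_gapRatio_onReal (hP : IsGapSet P) (hu : ∀ s, 0 < s → 0 < u s) (hab : a < b)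
    (hη : 0 < η) (hf : IsC1Diffeo f) (hfix : ∀ x : unitInterval, (x : ℝ) ∈ P → f x = x)
    (hfa : f a = a) (hfb : f b = b) :
    ContinuousOn (gapRatio P u a b η (onReal f)) (Icc 0 1) := by
  obtain ⟨C, -, hCa, hCb⟩ := exists_abs_log_endpoints_le hf hfa hfb
  exact continuousOn_gapRatio hP hu a.2.1 hab b.2.2 hη hf.strictMonoOn hf.contDiffOn.continuousOn
    (onReal_eq_self hfix) (by rw [onReal_coe, hfa]) (by rw [onReal_coe, hfb]) hCa hCb

theorem isC1Diffeo_conj (hP : IsGapSet P) (hu : ∀ s, 0 < s → 0 < u s) (hab : a < b)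
    (hη : 0 < η) (hmono : StrictMono h) (hd : HasDensity h fun x => c * gapDensity P u a b η x)
    (hf : IsC1Diffeo f) (hf' : IsC1Diffeo f⁻¹)
    (hfix : ∀ x : unitInterval, (x : ℝ) ∈ P → f x = x) (hfa : f a = a) (hfb : f b = b) :
    IsC1Diffeo (h * f * h⁻¹) := by
  have hinv : ∀ x, f x = x → (f⁻¹) x = x := fun x hx => by
    show f.symm x = x
    rw [Homeomorph.symm_apply_eq, hx]
  have hmono' : StrictMono (h⁻¹ : unitInterval ≃ₜ unitInterval) := fun x y hxy => by
    rw [← hmono.lt_iff_lt]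
    show h (h.symm x) < h (h.symm y)
    rwa [h.apply_symm_apply, h.apply_symm_apply]
  refine ⟨hmono.comp (hf.strictMono.comp hmono'), ?_, ?_⟩
  · exact contDiffOn_conj hd hmono hf (continuousOn_gapRatio_onReal hP hu hab hη hf hfix hfa hfb)
      fun x _ => gapDensity_onReal hP hu hη x
  · have : (h * f * h⁻¹).symm = h * f⁻¹ * h⁻¹ := by
      change (h * f * h⁻¹)⁻¹ = _
      group
    rw [this]
    exact contDiffOn_conj hd hmono hf' (continuousOn_gapRatio_onReal hP hu hab hη hf'
      (fun x hx => hinv x (hfix x hx)) (hinv a hfa) (hinv b hfb))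
      fun x _ => gapDensity_onReal hP hu hη x

/-- The bound `δ` is fixed before `u`, `η`, `c` and `h`, so that `u` and `h` can be constructed
after `η` has been chosen. -/
theorem exists_c1Close_conj (hP : IsGapSet P) (hab : a < b) (hf : IsC1Diffeo f)
    (hfix : ∀ x : unitInterval, (x : ℝ) ∈ P → f x = x) (hfa : f a = a) (hfb : f b = b)
    {ε : ℝ} (hε : 0 < ε) :
    ∃ δ : ℝ, 0 < δ ∧ ∀ (u : ℝ → ℝ) (η c : ℝ) (h : unitInterval ≃ₜ unitInterval),
      (∀ s, 0 < s → 0 < u s) → 0 < η → η ≤ δ → StrictMono h →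
      HasDensity h (fun x => c * gapDensity P u a b η x) →
      (∀ x : unitInterval, |(h x : ℝ) - x| ≤ δ) → C1Close ε f (h * f * h⁻¹) := by
  obtain ⟨C, hC0, hCa, hCb⟩ := exists_abs_log_endpoints_le hf hfa hfb
  obtain ⟨B, hB⟩ := isCompact_Icc.exists_bound_of_continuousOn hf.continuousOn_derivWithin
  have huc := (CompactSpace.uniformContinuous_of_continuous
    (f := fun x : unitInterval => ((f x : ℝ), derivOn f x))
    ((continuous_subtype_val.comp f.continuous).prodMk
      (continuousOn_iff_continuous_domRestrict.1 hf.continuousOn_derivWithin)))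
  obtain ⟨δ₁, hδ₁, huc⟩ := Metric.uniformContinuous_iff.1 huc (ε / 2) (by positivity)
  have hsmall : ∀ᶠ η in 𝓝[>] (0 : ℝ), B * (η * C * (2 + η * C)) < ε / 2 ∧ η < δ₁ ∧ η < ε / 2 := by
    refine eventually_nhdsWithin_of_eventually_nhds ?_
    have hc : Continuous fun η : ℝ => B * (η * C * (2 + η * C)) := by fun_prop
    have := hc.tendsto 0
    simp only [zero_mul, mul_zero] at this
    exact (this.eventually (gt_mem_nhds (by positivity))).and
      ((gt_mem_nhds hδ₁).and (gt_mem_nhds (by positivity)))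
  obtain ⟨δ, ⟨hδB, hδδ₁, hδε⟩, hδ⟩ := (hsmall.and self_mem_nhdsWithin).exists
  have hδ' : 0 < δ := hδ
  refine ⟨δ, hδ', fun u η c h hu hη hηδ hmono hd hclose y => ?_⟩
  obtain ⟨x, rfl⟩ := h.surjective y
  have hconj : (h * f * h⁻¹) (h x) = h (f x) := congrArg (fun w => h (f w)) (h.symm_apply_apply x)
  have hnear := huc (a := h x) (b := x) ((hclose x).trans_lt hδδ₁)
  rw [Prod.dist_eq, max_lt_iff, Real.dist_eq, Real.dist_eq] at hnear
  rw [hconj, derivOn_conj hd hmono hf (continuousOn_gapRatio_onReal hP hu hab hη hf hfix hfa hfb)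
    fun x _ => gapDensity_onReal hP hu hη x]
  constructor
  · have h2 := hclose (f x)
    rw [abs_sub_comm] at h2
    calc _ ≤ |(f (h x) : ℝ) - f x| + |(f x : ℝ) - h (f x)| := abs_sub_le _ _ _
      _ < ε := by linarith [hnear.1]
  · have hr := abs_gapRatio_sub_one_le hP hu a.2.1 hab b.2.2 hη.le hf.strictMonoOn
      (onReal_eq_self hfix) (by rw [onReal_coe, hfa]) (by rw [onReal_coe, hfb]) hC0 hCa hCb x.2
    have hB0 : |derivOn f x| ≤ B := hB x x.2
    have hBnn : 0 ≤ B := (abs_nonneg _).trans hB0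
    have h3 : |derivOn f x - derivOn f x * gapRatio P u a b η (onReal f) x| < ε / 2 := by
      rw [← mul_one_sub, abs_mul, abs_sub_comm 1]
      calc _ ≤ B * (η * C * (2 + η * C)) := by gcongr
        _ ≤ B * (δ * C * (2 + δ * C)) := by gcongr
        _ < _ := hδB
    calc _ ≤ |derivOn f (h x) - derivOn f x| +
          |derivOn f x - derivOn f x * gapRatio P u a b η (onReal f) x| := abs_sub_le _ _ _
      _ < ε := by linarith [hnear.2]

end Conjugation

/-! ### Orbits, commutative subgroups and commuting maps -/

section Orbits

variable {G : Type*} [Group G] {φ : G →* (unitInterval ≃ₜ unitInterval)}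

lemma action_inv_apply (φ : G →* (unitInterval ≃ₜ unitInterval)) (g : G) (x : unitInterval) :
    φ g⁻¹ (φ g x) = x := by
  rw [map_inv]
  exact (φ g).symm_apply_apply x

lemma action_apply_inv (φ : G →* (unitInterval ≃ₜ unitInterval)) (g : G) (x : unitInterval) :
    φ g (φ g⁻¹ x) = x := by
  rw [map_inv]
  exact (φ g).apply_symm_apply x

lemma action_mul_apply (φ : G →* (unitInterval ≃ₜ unitInterval)) (g k : G) (x : unitInterval) :
    φ (g * k) x = φ g (φ k x) := by
  rw [map_mul]
  rfl

lemma apply_sSup_eq (hφ : ∀ g, StrictMono (φ g)) {g : G} {S : Set unitInterval}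
    (h1 : ∀ x ∈ S, φ g x ∈ S) (h2 : ∀ x ∈ S, φ g⁻¹ x ∈ S) : φ g (sSup S) = sSup S := by
  apply le_antisymm
  · rw [← (hφ g⁻¹).le_iff_le, action_inv_apply]
    refine sSup_le fun x hx => ?_
    rw [← (hφ g).le_iff_le, action_apply_inv]
    exact le_sSup (h1 x hx)
  · refine sSup_le fun x hx => ?_
    rw [← (hφ g⁻¹).le_iff_le, action_inv_apply]
    exact le_sSup (h2 x hx)

lemma apply_sInf_eq (hφ : ∀ g, StrictMono (φ g)) {g : G} {S : Set unitInterval}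
    (h1 : ∀ x ∈ S, φ g x ∈ S) (h2 : ∀ x ∈ S, φ g⁻¹ x ∈ S) : φ g (sInf S) = sInf S := by
  apply le_antisymm
  · refine le_sInf fun x hx => ?_
    rw [← (hφ g⁻¹).le_iff_le, action_inv_apply]
    exact sInf_le (h2 x hx)
  · rw [← (hφ g⁻¹).le_iff_le, action_inv_apply]
    refine le_sInf fun x hx => ?_
    rw [← (hφ g).le_iff_le, action_apply_inv]
    exact sInf_le (h1 x hx)

/-- The orbit of a point under a subgroup. -/
def orbitOf (φ : G →* (unitInterval ≃ₜ unitInterval)) (N : Subgroup G) (x : unitInterval) :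
    Set unitInterval := (fun g => φ g x) '' N

lemma self_mem_orbitOf (N : Subgroup G) (x : unitInterval) : x ∈ orbitOf φ N x :=
  ⟨1, N.one_mem, by simp⟩

lemma apply_mem_orbitOf {N : Subgroup G} {x y : unitInterval} {g : G} (hg : g ∈ N)
    (hy : y ∈ orbitOf φ N x) : φ g y ∈ orbitOf φ N x := by
  obtain ⟨k, hk, rfl⟩ := hy
  exact ⟨g * k, N.mul_mem hg hk, action_mul_apply φ g k x⟩

variable {N : Subgroup G} {a b : unitInterval}

lemma apply_mem_Ioo (hφ : ∀ g, StrictMono (φ g)) (ha : ∀ g, φ g a = a) (hb : ∀ g, φ g b = b)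
    (g : G) {x : unitInterval} (hx : x ∈ Ioo a b) : φ g x ∈ Ioo a b := by
  have h1 := hφ g hx.1
  have h2 := hφ g hx.2
  rw [ha] at h1
  rw [hb] at h2
  exact ⟨h1, h2⟩

/-- The infimum of the orbit is fixed by `N`, so it cannot lie in `(a, b)` and must be `a`. -/
lemma exists_apply_lt (hφ : ∀ g, StrictMono (φ g)) (ha : ∀ g, φ g a = a)
    (hN : ∀ x ∈ Ioo a b, ∃ g ∈ N, φ g x ≠ x) {x y : unitInterval} (hx : x ∈ Ioo a b)
    (hy : a < y) : ∃ g ∈ N, φ g x < y := by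
  have hinf : sInf (orbitOf φ N x) = a := by
    have h1 : a ≤ sInf (orbitOf φ N x) := le_sInf fun z ⟨g, _, hz⟩ => by
      rw [← hz, ← ha g]
      exact (hφ g).monotone hx.1.le
    by_contra hne
    obtain ⟨g, hg, hg'⟩ := hN _ ⟨lt_of_le_of_ne h1 (Ne.symm hne),
      (sInf_le (self_mem_orbitOf N x)).trans_lt hx.2⟩
    exact hg' (apply_sInf_eq hφ (fun z hz => apply_mem_orbitOf hg hz)
      fun z hz => apply_mem_orbitOf (N.inv_mem hg) hz)
  rw [← hinf, sInf_lt_iff] at hy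
  obtain ⟨_, ⟨g, hg, rfl⟩, h⟩ := hy
  exact ⟨g, hg, h⟩

lemma exists_lt_apply (hφ : ∀ g, StrictMono (φ g)) (hb : ∀ g, φ g b = b)
    (hN : ∀ x ∈ Ioo a b, ∃ g ∈ N, φ g x ≠ x) {x y : unitInterval} (hx : x ∈ Ioo a b)
    (hy : y < b) : ∃ g ∈ N, y < φ g x := by
  have hsup : sSup (orbitOf φ N x) = b := by
    have h1 : sSup (orbitOf φ N x) ≤ b := sSup_le fun z ⟨g, _, hz⟩ => by
      rw [← hz, ← hb g]
      exact (hφ g).monotone hx.2.le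
    by_contra hne
    obtain ⟨g, hg, hg'⟩ := hN _ ⟨hx.1.trans_le (le_sSup (self_mem_orbitOf N x)),
      lt_of_le_of_ne h1 hne⟩
    exact hg' (apply_sSup_eq hφ (fun z hz => apply_mem_orbitOf hg hz)
      fun z hz => apply_mem_orbitOf (N.inv_mem hg) hz)
  rw [← hsup, lt_sSup_iff] at hy
  obtain ⟨_, ⟨g, hg, rfl⟩, h⟩ := hy
  exact ⟨g, hg, h⟩

/-- Either `N` or the cyclic group of `t` works. If `N` fixes `x` and `t` fixes `s`, both in `(a,
b)`, then normality makes `N` fix the whole `t`-orbit of `x`; its supremum or infimum, on the side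
of `s`, stays in `(a, b)` and is a global fixed point. -/
theorem exists_commutative_subgroup (hφ : ∀ g, StrictMono (φ g)) [N.Normal]
    (hcomm : ∀ g ∈ N, ∀ k ∈ N, g * k = k * g) {t : G}
    (hgen : ∀ x, (∀ g ∈ N, φ g x = x) → φ t x = x → ∀ g, φ g x = x)
    (hgap : ∀ x ∈ Ioo a b, ∃ g, φ g x ≠ x) :
    ∃ N' : Subgroup G, (∀ g ∈ N', ∀ k ∈ N', g * k = k * g) ∧
      ∀ x ∈ Ioo a b, ∃ g ∈ N', φ g x ≠ x := by
  by_cases hN : ∀ x ∈ Ioo a b, ∃ g ∈ N, φ g x ≠ x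
  · exact ⟨N, hcomm, hN⟩
  push Not at hN
  obtain ⟨x, hx, hxN⟩ := hN
  refine ⟨Subgroup.zpowers t, ?_, fun s hs => ?_⟩
  · rintro _ ⟨m, rfl⟩ _ ⟨n, rfl⟩
    exact ((Commute.refl t).zpow_zpow m n).eq
  by_contra! hst
  have ht : t ∈ Subgroup.zpowers t := Subgroup.mem_zpowers t
  have horb : ∀ g ∈ N, ∀ y ∈ orbitOf φ (Subgroup.zpowers t) x, φ g y = y := by
    rintro g hg _ ⟨k, -, rfl⟩
    have h1 := hxN (k⁻¹ * g * k) (by simpa using (inferInstance : N.Normal).conj_mem g hg k⁻¹)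
    calc φ g (φ k x) = φ (k * (k⁻¹ * g * k)) x := by
          rw [← action_mul_apply]
          congr 2
          group
      _ = φ k x := by rw [action_mul_apply, h1]
  have horb' : ∀ g ∈ N, ∀ y ∈ orbitOf φ (Subgroup.zpowers t) x,
      φ g y ∈ orbitOf φ (Subgroup.zpowers t) x := fun g hg y hy => by rwa [horb g hg y hy]
  rcases le_total x s with hxs | hxs
  · obtain ⟨g, hg⟩ := hgap (sSup (orbitOf φ (Subgroup.zpowers t) x))
      ⟨hx.1.trans_le (le_sSup (self_mem_orbitOf _ x)), lt_of_le_of_lt (sSup_le (by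
        rintro _ ⟨k, hk, rfl⟩
        rw [← hst k hk]
        exact (hφ k).monotone hxs)) hs.2⟩
    exact hg (hgen _ (fun k hk => apply_sSup_eq hφ (horb' k hk) (horb' _ (N.inv_mem hk)))
      (apply_sSup_eq hφ (fun _ hy => apply_mem_orbitOf ht hy)
        fun _ hy => apply_mem_orbitOf (inv_mem ht) hy) g)
  · obtain ⟨g, hg⟩ := hgap (sInf (orbitOf φ (Subgroup.zpowers t) x))
      ⟨hs.1.trans_le (le_sInf (by
        rintro _ ⟨k, hk, rfl⟩
        rw [← hst k hk]
        exact (hφ k).monotone hxs)), (sInf_le (self_mem_orbitOf _ x)).trans_lt hx.2⟩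
    exact hg (hgen _ (fun k hk => apply_sInf_eq hφ (horb' k hk) (horb' _ (N.inv_mem hk)))
      (apply_sInf_eq hφ (fun _ hy => apply_mem_orbitOf ht hy)
        fun _ hy => apply_mem_orbitOf (inv_mem ht) hy) g)

/-- The homeomorphism `c` commutes with the action `φ`. -/
def CommutesWith (c : unitInterval ≃ₜ unitInterval) (φ : G →* (unitInterval ≃ₜ unitInterval)) :
    Prop := ∀ g x, c (φ g x) = φ g (c x)

/-- If `k ∈ N` moves `z` below `c z`, then commutation carries this to every point `g z` with `g ∈
N`: `k (g z) ≤ c (g z)`. As `k` is bi-Lipschitz and fixes `a`, `c` cannot contract strongly towards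
`a` at these points, which accumulate at `a`. -/
theorem exists_mul_sub_le_left (hφ : IsC1Action φ) (ha : ∀ g, φ g a = a) (hb : ∀ g, φ g b = b)
    (hab : a < b) (hcomm : ∀ g ∈ N, ∀ k ∈ N, g * k = k * g)
    (hN : ∀ x ∈ Ioo a b, ∃ g ∈ N, φ g x ≠ x) {c : unitInterval ≃ₜ unitInterval}
    (hc : CommutesWith c φ) (hmono : StrictMono c) (hca : c a = a) (hcb : c b = b) :
    ∃ K : ℝ, 0 < K ∧ ∀ y, a < y → ∃ x ∈ Ioo a b, a < c x ∧ c x < y ∧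
      (x : ℝ) - a ≤ K * (c x - a) := by
  have hφ' : ∀ g, StrictMono (φ g) := fun g => (hφ g).strictMono
  obtain ⟨z, hz⟩ := exists_between hab
  have hcI : ∀ x ∈ Ioo a b, c x ∈ Ioo a b := fun x hx =>
    ⟨hca ▸ hmono hx.1, (hmono hx.2).trans_eq hcb⟩
  obtain ⟨k, hk, hkz⟩ := exists_apply_lt hφ' ha hN hz (hcI z hz).1
  obtain ⟨K, hK1, -, hK⟩ := (hφ k).exists_abs_sub_le
  refine ⟨K, by linarith, fun y hy => ?_⟩
  obtain ⟨g, hg, hgz⟩ := exists_apply_lt hφ' ha hN (hcI z hz) hy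
  have hx := apply_mem_Ioo hφ' ha hb g hz
  have hcx := hcI _ hx
  have hle : φ k (φ g z) ≤ c (φ g z) := by
    rw [hc, ← action_mul_apply, hcomm k hk g hg, action_mul_apply]
    exact (hφ' g).monotone hkz.le
  refine ⟨φ g z, hx, hcx.1, by rwa [hc], ?_⟩
  have h1 := hK (φ g z) a
  rw [ha] at h1
  have h2 := (apply_mem_Ioo hφ' ha hb k hx).1
  rw [abs_of_pos (sub_pos.2 (show (a : ℝ) < φ g z from hx.1)),
    abs_of_pos (sub_pos.2 (show (a : ℝ) < φ k (φ g z) from h2))] at h1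
  have h3 : ((φ k (φ g z) : unitInterval) : ℝ) ≤ c (φ g z) := hle
  exact h1.trans (by gcongr)

theorem exists_mul_sub_le_right (hφ : IsC1Action φ) (ha : ∀ g, φ g a = a) (hb : ∀ g, φ g b = b)
    (hab : a < b) (hcomm : ∀ g ∈ N, ∀ k ∈ N, g * k = k * g)
    (hN : ∀ x ∈ Ioo a b, ∃ g ∈ N, φ g x ≠ x) {c : unitInterval ≃ₜ unitInterval}
    (hc : CommutesWith c φ) (hmono : StrictMono c) (hca : c a = a) (hcb : c b = b) :
    ∃ K : ℝ, 0 < K ∧ ∀ y, y < b → ∃ x ∈ Ioo a b, y < c x ∧ c x < b ∧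
      (b : ℝ) - c x ≤ K * (b - x) := by
  have hφ' : ∀ g, StrictMono (φ g) := fun g => (hφ g).strictMono
  obtain ⟨z, hz⟩ := exists_between hab
  have hcI : ∀ x ∈ Ioo a b, c x ∈ Ioo a b := fun x hx =>
    ⟨hca ▸ hmono hx.1, (hmono hx.2).trans_eq hcb⟩
  -- Here `k` moves `c z` above `z`, so `g z ≤ k (c (g z))`; its bi-Lipschitz constant then bounds
  -- the expansion away from `b`.
  obtain ⟨k, hk, hkz⟩ := exists_lt_apply hφ' hb hN (hcI z hz) hz.2
  obtain ⟨K, hK1, -, hK⟩ := (hφ k).exists_abs_sub_le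
  refine ⟨K, by linarith, fun y hy => ?_⟩
  obtain ⟨g, hg, hgz⟩ := exists_lt_apply hφ' hb hN (hcI z hz) hy
  have hx := apply_mem_Ioo hφ' ha hb g hz
  have hcx := hcI _ hx
  have hle : φ g z ≤ φ k (c (φ g z)) := by
    rw [hc, ← action_mul_apply, hcomm k hk g hg, action_mul_apply]
    exact (hφ' g).monotone hkz.le
  refine ⟨φ g z, hx, by rwa [hc], hcx.2, ?_⟩
  have h1 := hK b (c (φ g z))
  rw [hb] at h1
  have h2 := (apply_mem_Ioo hφ' ha hb k hcx).2
  rw [abs_of_pos (sub_pos.2 (show (c (φ g z) : ℝ) < b from hcx.2)),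
    abs_of_pos (sub_pos.2 (show ((φ k (c (φ g z)) : unitInterval) : ℝ) < b from h2))] at h1
  have h3 : (φ g z : ℝ) ≤ φ k (c (φ g z)) := hle
  exact h1.trans (by gcongr)

end Orbits

/-! ### The centralizer permutes the gaps -/

section Centralizer

variable {G : Type*} [Group G] {φ : G →* (unitInterval ≃ₜ unitInterval)}
  {a b : unitInterval} {c e : unitInterval ≃ₜ unitInterval}

namespace CommutesWith

lemma one : CommutesWith 1 φ := fun _ _ => rfl

lemma mul (hc : CommutesWith c φ) (he : CommutesWith e φ) : CommutesWith (c * e) φ := fun g x => by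
  show c (e _) = φ g (c (e x))
  rw [he, hc]

lemma inv (hc : CommutesWith c φ) : CommutesWith c⁻¹ φ := fun g x => by
  show c.symm (φ g x) = φ g (c.symm x)
  rw [Homeomorph.symm_apply_eq, hc, c.apply_symm_apply]

lemma pow (hc : CommutesWith c φ) (n : ℕ) : CommutesWith (c ^ n) φ := by
  induction n with
  | zero => exact one
  | succ n ih => rw [pow_succ]; exact ih.mul hc

lemma fixed_iff (hc : CommutesWith c φ) {x : unitInterval} :
    (∀ g, φ g (c x) = c x) ↔ ∀ g, φ g x = x := by
  refine forall_congr' fun g => ?_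
  rw [← hc, c.injective.eq_iff]

end CommutesWith

lemma homeomorph_strictMono_or_strictAnti (e : unitInterval ≃ₜ unitInterval) :
    StrictMono e ∨ StrictAnti e :=
  e.continuous.strictMono_of_inj_boundedOrder' e.injective

/-- `(a,b)` is a component of the set of points not fixed by the action `φ`. -/
structure IsGapOf (φ : G →* (unitInterval ≃ₜ unitInterval)) (a b : unitInterval) : Prop where
  lt : a < b
  left_fixed : ∀ g, φ g a = a
  right_fixed : ∀ g, φ g b = b
  not_fixed : ∀ x ∈ Ioo a b, ∃ g, φ g x ≠ x

/-- `e` maps the interval with end points `a`, `b` to itself. -/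
def PreservesEnds (e : unitInterval ≃ₜ unitInterval) (a b : unitInterval) : Prop :=
  (e a = a ∧ e b = b) ∨ (e a = b ∧ e b = a)

lemma IsGapOf.eq_of_mem {p q x : unitInterval} (hab : IsGapOf φ a b) (hpq : IsGapOf φ p q)
    (hx : x ∈ Ioo a b) (hx' : x ∈ Ioo p q) : p = a ∧ q = b := by
  have key : ∀ {p q p' q' : unitInterval}, IsGapOf φ p q → IsGapOf φ p' q' → x ∈ Ioo p q →
      x ∈ Ioo p' q' → p ≤ p' ∧ q' ≤ q := by
    intro p q p' q' h h' hx hx'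
    constructor
    · by_contra! hlt
      obtain ⟨g, hg⟩ := h'.not_fixed p ⟨hlt, hx.1.trans hx'.2⟩
      exact hg (h.left_fixed g)
    · by_contra! hlt
      obtain ⟨g, hg⟩ := h'.not_fixed q ⟨hx'.1.trans hx.2, hlt⟩
      exact hg (h.right_fixed g)
  have h1 := key hab hpq hx hx'
  have h2 := key hpq hab hx' hx
  exact ⟨le_antisymm h2.1 h1.1, le_antisymm h1.2 h2.2⟩

/-- A commuting map preserves the set of global fixed points. It may reverse orientation, hence the
minimum and maximum. -/
lemma IsGapOf.map (hab : IsGapOf φ a b) (he : CommutesWith e φ) :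
    IsGapOf φ (min (e a) (e b)) (max (e a) (e b)) := by
  have hea := he.fixed_iff.2 hab.left_fixed
  have heb := he.fixed_iff.2 hab.right_fixed
  have key : ∀ x, e.symm x ∈ Ioo a b → ∃ g, φ g x ≠ x := fun x hx => by
    by_contra! h
    obtain ⟨g, hg⟩ := hab.not_fixed _ hx
    refine hg (he.fixed_iff.1 ?_ g)
    rwa [e.apply_symm_apply]
  rcases homeomorph_strictMono_or_strictAnti e with h | h
  · rw [min_eq_left (h hab.lt).le, max_eq_right (h hab.lt).le]
    refine ⟨h hab.lt, hea, heb, fun x hx => key x ⟨?_, ?_⟩⟩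
    · rw [← h.lt_iff_lt, e.apply_symm_apply]; exact hx.1
    · rw [← h.lt_iff_lt, e.apply_symm_apply]; exact hx.2
  · rw [min_eq_right (h hab.lt).le, max_eq_left (h hab.lt).le]
    refine ⟨h hab.lt, heb, hea, fun x hx => key x ⟨?_, ?_⟩⟩
    · rw [← h.lt_iff_gt, e.apply_symm_apply]; exact hx.2
    · rw [← h.lt_iff_gt, e.apply_symm_apply]; exact hx.1

lemma preservesEnds_of_min_max (h : min (e a) (e b) = a ∧ max (e a) (e b) = b) :
    PreservesEnds e a b := by
  rcases le_total (e a) (e b) with hle | hle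
  · rw [min_eq_left hle, max_eq_right hle] at h
    exact .inl h
  · rw [min_eq_right hle, max_eq_left hle] at h
    exact .inr ⟨h.2, h.1⟩

/-- A decreasing map exchanging `a` and `b` has a fixed point inside the gap, and a decreasing map
has at most one. Commutation then makes this point fixed by the whole action, which is impossible in
a gap. -/
lemma apply_eq_of_preservesEnds (hab : IsGapOf φ a b) (he : CommutesWith e φ)
    (h : PreservesEnds e a b) : StrictMono e ∧ e a = a ∧ e b = b := by
  rcases homeomorph_strictMono_or_strictAnti e with hm | hm
  · rcases h with h | h
    · exact ⟨hm, h⟩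
    · have := hm hab.lt
      rw [h.1, h.2] at this
      exact absurd this (lt_asymm hab.lt)
  · exfalso
    rcases h with h | h
    · have := hm hab.lt
      rw [h.1, h.2] at this
      exact lt_asymm hab.lt this
    have huniq : ∀ x y, e x = x → e y = y → x = y := fun x y hx hy => by
      rcases lt_trichotomy x y with hxy | hxy | hxy
      · have := hm hxy
        rw [hx, hy] at this
        exact absurd this (lt_asymm hxy)
      · exact hxy
      · have := hm hxy
        rw [hx, hy] at this
        exact absurd this (lt_asymm hxy)
    obtain ⟨s, hs, hse⟩ : ∃ s ∈ Icc a b, e s = s :=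
      exists_mem_Icc_isFixedPt e.continuous.continuousOn hab.lt.le
        (by rw [h.1]; exact hab.lt.le) (by rw [h.2]; exact hab.lt.le)
    have hsa : s ≠ a := fun hsa => hab.lt.ne (by rw [← h.1, ← hsa, hse])
    have hsb : s ≠ b := fun hsb => hab.lt.ne (by rw [← h.2, ← hsb, hse])
    obtain ⟨g, hg⟩ := hab.not_fixed s ⟨lt_of_le_of_ne hs.1 (Ne.symm hsa), lt_of_le_of_ne hs.2 hsb⟩
    exact hg (huniq _ _ (by rw [he, hse]) hse)

/-- Two gaps that meet are equal, so the images of the gap under the powers of `c` are pairwise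
disjoint and their lengths are summable. -/
lemma tendsto_dist_pow_zero (hab : IsGapOf φ a b) (hc : CommutesWith c φ)
    (h : ∀ n : ℕ, 0 < n → ¬ PreservesEnds (c ^ n) a b) :
    Tendsto (fun n : ℕ => |((c ^ n) a : ℝ) - (c ^ n) b|) atTop (𝓝 0) := by
  have himage : ∀ (e : unitInterval ≃ₜ unitInterval), e '' Ioo a b = uIoo (e a) (e b) := by
    intro e
    ext y
    obtain ⟨x, rfl⟩ := e.surjective y
    rw [e.injective.mem_set_image]
    rcases homeomorph_strictMono_or_strictAnti e with hm | hm
    · rw [uIoo_of_le (hm hab.lt).le, mem_Ioo, mem_Ioo, hm.lt_iff_lt, hm.lt_iff_lt]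
    · rw [uIoo_of_ge (hm hab.lt).le, mem_Ioo, mem_Ioo, hm.lt_iff_gt, hm.lt_iff_gt, and_comm]
  have hdisj : ∀ m n : ℕ, m < n →
      Disjoint (uIoo ((c ^ m) a) ((c ^ m) b)) (uIoo ((c ^ n) a) ((c ^ n) b)) := by
    intro m n hmn
    rw [Set.disjoint_left, ← himage, ← himage]
    rintro _ ⟨x, hx, rfl⟩ ⟨y, hy, hxy⟩
    obtain ⟨k, rfl⟩ := Nat.exists_eq_add_of_lt hmn
    have hxy' : (c ^ (k + 1)) y = x := by
      apply (c ^ m).injective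
      rw [← hxy, add_assoc, pow_add c m]
      rfl
    refine h (k + 1) k.succ_pos (preservesEnds_of_min_max
      (hab.eq_of_mem (hab.map (hc.pow (k + 1))) hx ?_))
    have : (c ^ (k + 1)) y ∈ uIoo ((c ^ (k + 1)) a) ((c ^ (k + 1)) b) := by
      rw [← himage]
      exact mem_image_of_mem _ hy
    rw [← hxy']
    exact this
  have hpair : Pairwise (Function.onFun Disjoint
      fun n : ℕ => uIoo ((c ^ n) a) ((c ^ n) b)) := fun m n hmn => by
    rcases lt_or_gt_of_ne hmn with h | h
    · exact hdisj m n h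
    · exact (hdisj n m h).symm
  have hsum := measure_iUnion (μ := (volume : Measure unitInterval)) hpair
    fun n => isOpen_Ioo.measurableSet
  have hlim := ENNReal.tendsto_atTop_zero_of_tsum_ne_top (hsum ▸ measure_ne_top _ _)
  simp only [unitInterval.volume_uIoo] at hlim
  have := (ENNReal.tendsto_toReal ENNReal.zero_ne_top).comp hlim
  refine this.congr fun n => ?_
  show (edist ((c ^ n) b) ((c ^ n) a)).toReal = _
  rw [edist_dist, ENNReal.toReal_ofReal dist_nonneg, dist_comm]
  rfl

end Centralizer

/-! ### Singularities of the primitive at the ends of the chosen gap -/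

section Singular

variable {h : unitInterval ≃ₜ unitInterval} {P : Set ℝ} {u : ℝ → ℝ} {a b : unitInterval}
  {η c : ℝ}

lemma tendsto_gapDensity_left (hab : a < b) (hη : 0 < η) :
    Tendsto (gapDensity P u a b η) (𝓝[>] (a : ℝ)) atTop := by
  have hab' : (a : ℝ) < b := hab
  have hd : Tendsto (fun x : ℝ => x - a) (𝓝[>] (a : ℝ)) (𝓝[>] 0) := by
    refine tendsto_nhdsWithin_iff.2 ⟨?_, eventually_mem_nhdsWithin.mono fun x hx =>
      mem_Ioi.2 (sub_pos.2 hx)⟩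
    have : Tendsto (fun x : ℝ => x - a) (𝓝 (a : ℝ)) (𝓝 (a - a)) := tendsto_id.sub_const _
    rw [sub_self] at this
    exact this.mono_left nhdsWithin_le_nhds
  have hLpos := one_le_logWeight hη.le (sub_pos.2 hab').le (by linarith [a.2.1, b.2.2])
  have h2 := (((continuousAt_logWeight (η := η) (sub_pos.2 hab').ne').tendsto.comp
    ((tendsto_nhdsWithin_of_tendsto_nhds tendsto_id).const_sub (b : ℝ))).inv₀ (by linarith) :
      Tendsto _ (𝓝[>] (a : ℝ)) _)
  refine (((tendsto_logWeight hη).comp hd).atTop_mul_pos (inv_pos.2 (by linarith)) h2).congr' ?_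
  filter_upwards [Ioo_mem_nhdsGT hab'] with x hx
  rw [gapDensity_of_mem hx]
  rfl

lemma tendsto_gapDensity_right (hab : a < b) (hη : 0 < η) :
    Tendsto (gapDensity P u a b η) (𝓝[<] (b : ℝ)) (𝓝 0) := by
  have hab' : (a : ℝ) < b := hab
  have hd : Tendsto (fun x : ℝ => b - x) (𝓝[<] (b : ℝ)) (𝓝[>] 0) := by
    refine tendsto_nhdsWithin_iff.2 ⟨?_, eventually_mem_nhdsWithin.mono fun x hx =>
      mem_Ioi.2 (sub_pos.2 hx)⟩
    have : Tendsto (fun x : ℝ => b - x) (𝓝 (b : ℝ)) (𝓝 (b - b)) := tendsto_id.const_sub _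
    rw [sub_self] at this
    exact this.mono_left nhdsWithin_le_nhds
  have h2 := ((continuousAt_logWeight (η := η) (sub_pos.2 hab').ne').tendsto.comp
    ((tendsto_nhdsWithin_of_tendsto_nhds tendsto_id).sub_const (a : ℝ)) :
      Tendsto _ (𝓝[<] (b : ℝ)) _)
  have h3 := h2.mul ((tendsto_logWeight hη).comp hd).inv_tendsto_atTop
  rw [mul_zero] at h3
  refine h3.congr' ?_
  filter_upwards [Ioo_mem_nhdsLT hab'] with x hx
  rw [gapDensity_of_mem hx]
  rfl

lemma exists_le_sub_left (hd : HasDensity h fun x => c * gapDensity P u a b η x) (hc : 0 < c)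
    (hab : a < b) (hη : 0 < η) (B : ℝ) :
    ∃ y : unitInterval, a < y ∧ ∀ z : unitInterval, a < z → z < y →
      B * ((z : ℝ) - a) ≤ h z - h a := by
  have hev := (tendsto_gapDensity_left (P := P) (u := u) hab hη).eventually_ge_atTop (c⁻¹ * B)
  obtain ⟨y, hy, hsub⟩ := (mem_nhdsGT_iff_exists_mem_Ioc_Ioo_subset
    (show (a : ℝ) < b from hab)).1 hev
  refine ⟨⟨y, a.2.1.trans hy.1.le, hy.2.trans b.2.2⟩, hy.1, fun z haz hzy => ?_⟩
  have haz' : (a : ℝ) ≤ z := haz.le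
  rw [hd.sub_eq, mul_comm, ← smul_eq_mul, ← intervalIntegral.integral_const]
  refine intervalIntegral.integral_mono_on_of_le_Ioo haz' (by simp)
    (intervalIntegrable_of_mem hd.integrableOn a.2 z.2) fun t ht => ?_
  have : c⁻¹ * B ≤ gapDensity P u a b η t := hsub ⟨ht.1, ht.2.trans hzy⟩
  rwa [inv_mul_le_iff₀ hc] at this

lemma exists_sub_le_right (hd : HasDensity h fun x => c * gapDensity P u a b η x) (hc : 0 < c)
    (hab : a < b) (hη : 0 < η) {B : ℝ} (hB : 0 < B) :
    ∃ y : unitInterval, y < b ∧ ∀ z : unitInterval, y < z → z < b →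
      (h b : ℝ) - h z ≤ B * ((b : ℝ) - z) := by
  have hev := (tendsto_gapDensity_right (P := P) (u := u) hab hη).eventually
    (ge_mem_nhds (show 0 < c⁻¹ * B by positivity))
  obtain ⟨y, hy, hsub⟩ := (mem_nhdsLT_iff_exists_mem_Ico_Ioo_subset
    (show (a : ℝ) < b from hab)).1 hev
  refine ⟨⟨y, a.2.1.trans hy.1, hy.2.le.trans b.2.2⟩, hy.2, fun z hyz hzb => ?_⟩
  have hzb' : (z : ℝ) ≤ b := hzb.le
  rw [hd.sub_eq, mul_comm, ← smul_eq_mul, ← intervalIntegral.integral_const]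
  refine intervalIntegral.integral_mono_on_of_le_Ioo hzb'
    (intervalIntegrable_of_mem hd.integrableOn z.2 b.2) (by simp) fun t ht => ?_
  have : gapDensity P u a b η t ≤ c⁻¹ * B := hsub ⟨lt_trans hyz ht.1, ht.2⟩
  rwa [le_inv_mul_iff₀ hc] at this

end Singular

/-! ### Global fixed points and affinity on the other gaps -/

section FixedGapSet

variable {G : Type*} [Group G] {φ : G →* (unitInterval ≃ₜ unitInterval)}

/-- The global fixed points of an action on `[0,1]`, together with the complement of `(0,1)`. -/
def fixedGapSet (φ : G →* (unitInterval ≃ₜ unitInterval)) : Set ℝ :=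
  (Iic 0 ∪ Ici 1) ∪ Subtype.val '' {x : unitInterval | ∀ g, φ g x = x}

lemma isGapSet_fixedGapSet (φ : G →* (unitInterval ≃ₜ unitInterval)) :
    IsGapSet (fixedGapSet φ) where
  closed := by
    have h : IsClosed {x : unitInterval | ∀ g, φ g x = x} := by
      rw [ofPred_forall]
      exact isClosed_iInter fun g => isClosed_eq (φ g).continuous continuous_id
    exact (isClosed_Iic.union isClosed_Ici).union
      (h.isCompact.image continuous_subtype_val).isClosed
  Iic_subset := subset_union_left.trans subset_union_left
  Ici_subset := subset_union_right.trans subset_union_left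

lemma coe_mem_fixedGapSet (hφ : ∀ g, StrictMono (φ g)) {x : unitInterval} :
    (x : ℝ) ∈ fixedGapSet φ ↔ ∀ g, φ g x = x := by
  constructor
  · rintro ((h | h) | ⟨y, hy, hyx⟩)
    · have : x = 0 := le_antisymm h unitInterval.nonneg'
      rw [this]
      exact fun g => (hφ g).homeomorph_zero
    · have : x = 1 := le_antisymm unitInterval.le_one' h
      rw [this]
      exact fun g => (hφ g).homeomorph_one
    · rw [← Subtype.ext hyx]
      exact hy
  · exact fun h => .inr ⟨x, h, rfl⟩

lemma exists_isGapOf (hφ : ∀ g, StrictMono (φ g)) {g : G} {x : unitInterval} (hx : φ g x ≠ x) :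
    ∃ a b, IsGapOf φ a b := by
  have hP := isGapSet_fixedGapSet φ
  have hxP : (x : ℝ) ∉ fixedGapSet φ := fun h => hx ((coe_mem_fixedGapSet hφ).1 h g)
  have h1 := hP.gapLeft_lt hxP
  have h2 := hP.lt_gapRight hxP
  refine ⟨⟨_, hP.gapLeft_nonneg x.2.1, h1.le.trans x.2.2⟩,
    ⟨_, x.2.1.trans h2.le, hP.gapRight_le_one x.2.2⟩, h1.trans h2,
    (coe_mem_fixedGapSet hφ).1 (hP.gapLeft_mem x), (coe_mem_fixedGapSet hφ).1 (hP.gapRight_mem x),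
    fun y hy => ?_⟩
  have := mt (coe_mem_fixedGapSet hφ).2 (hP.not_mem_of_mem_Ioo (show (y : ℝ) ∈ Ioo _ _ from hy))
  push Not at this
  exact this

variable {h e : unitInterval ≃ₜ unitInterval} {u : ℝ → ℝ} {a b p q : unitInterval} {η c : ℝ}

lemma sub_eq_of_isGapOf (hφ : ∀ g, StrictMono (φ g))
    (hd : HasDensity h fun x => c * gapDensity (fixedGapSet φ) u a b η x)
    (hab : IsGapOf φ a b) (hpq : IsGapOf φ p q) (hne : ¬ (p = a ∧ q = b)) {x y : unitInterval}
    (hx : x ∈ Icc p q) (hy : y ∈ Icc p q) (hxy : x ≤ y) :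
    (h y : ℝ) - h x = c * (u ((q : ℝ) - p) / ((q : ℝ) - p)) * ((y : ℝ) - x) := by
  have hxy' : (x : ℝ) ≤ y := hxy
  have hpq' : (p : ℝ) < q := hpq.lt
  rw [hd.sub_eq, intervalIntegral.integral_of_le hxy', integral_Ioc_eq_integral_Ioo,
    setIntegral_congr_fun (g := fun _ => c * (u ((q : ℝ) - p) / ((q : ℝ) - p))) measurableSet_Ioo
      fun t ht => ?_]
  · rw [setIntegral_const, smul_eq_mul, mul_comm, Real.volume_real_Ioo_of_le hxy']
  · have htpq : t ∈ Ioo (p : ℝ) q := ⟨lt_of_le_of_lt hx.1 ht.1, lt_of_lt_of_le ht.2 hy.2⟩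
    have htI : t ∈ Icc (0 : ℝ) 1 := ⟨p.2.1.trans htpq.1.le, htpq.2.le.trans q.2.2⟩
    have htab : t ∉ Ioo (a : ℝ) b := fun htab =>
      hne (hab.eq_of_mem hpq (x := ⟨t, htI⟩) htab htpq)
    have hP := isGapSet_fixedGapSet φ
    have hlen : gapLength (fixedGapSet φ) t = q - p :=
      hP.gapLength_eq ((coe_mem_fixedGapSet hφ).2 hpq.left_fixed)
        ((coe_mem_fixedGapSet hφ).2 hpq.right_fixed) htpq fun s hs hsP => by
          obtain ⟨g, hg⟩ := hpq.not_fixed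
            ⟨s, p.2.1.trans hs.1.le, hs.2.le.trans q.2.2⟩ hs
          exact hg ((coe_mem_fixedGapSet hφ).1 hsP g)
    simp only [gapDensity_of_not_mem htab, hlen, slopeAt, if_neg (sub_pos.2 hpq').ne']

/-- The image of the gap is a gap other than `(a, b)`, on which the density is constant. Absolute
values absorb a possible reversal of orientation by `e`. -/
lemma abs_sub_eq_of_not_preservesEnds (hφ : ∀ g, StrictMono (φ g))
    (hd : HasDensity h fun x => c * gapDensity (fixedGapSet φ) u a b η x)
    (hmono : StrictMono h) (hab : IsGapOf φ a b) (he : CommutesWith e φ)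
    (hne : ¬ PreservesEnds e a b) {x y : unitInterval} (hx : x ∈ Icc a b) (hy : y ∈ Icc a b) :
    |(h (e x) : ℝ) - h (e y)| =
      c * (u |(e a : ℝ) - e b| / |(e a : ℝ) - e b|) * |(e x : ℝ) - e y| := by
  have hmem : ∀ x ∈ Icc a b, e x ∈ Icc (min (e a) (e b)) (max (e a) (e b)) := fun x hx => by
    rcases homeomorph_strictMono_or_strictAnti e with hm | hm
    · exact ⟨(min_le_left _ _).trans (hm.monotone hx.1),
        (hm.monotone hx.2).trans (le_max_right _ _)⟩
    · exact ⟨(min_le_right _ _).trans (hm.antitone hx.2),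
        (hm.antitone hx.1).trans (le_max_left _ _)⟩
  have hlen : ((max (e a) (e b) : unitInterval) : ℝ) - (min (e a) (e b) : unitInterval) =
      |(e a : ℝ) - e b| := by
    rcases le_total (e a) (e b) with hle | hle
    · have hle' : (e a : ℝ) ≤ e b := hle
      rw [max_eq_right hle, min_eq_left hle, abs_sub_comm, abs_of_nonneg (sub_nonneg.2 hle')]
    · have hle' : (e b : ℝ) ≤ e a := hle
      rw [max_eq_left hle, min_eq_right hle, abs_of_nonneg (sub_nonneg.2 hle')]
  have key : ∀ x ∈ Icc a b, ∀ y ∈ Icc a b, e x ≤ e y → |(h (e x) : ℝ) - h (e y)| =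
      c * (u |(e a : ℝ) - e b| / |(e a : ℝ) - e b|) * |(e x : ℝ) - e y| := by
    intro x hx y hy hxy
    have hh : (h (e x) : ℝ) ≤ h (e y) := hmono.monotone hxy
    have hxy' : (e x : ℝ) ≤ e y := hxy
    have := sub_eq_of_isGapOf hφ hd hab (hab.map he)
      (fun h => hne (preservesEnds_of_min_max h)) (hmem x hx) (hmem y hy) hxy
    rw [hlen] at this
    rw [abs_sub_comm, abs_of_nonneg (sub_nonneg.2 hh), abs_sub_comm (e x : ℝ),
      abs_of_nonneg (sub_nonneg.2 hxy'), this]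
  rcases le_total (e x) (e y) with hle | hle
  · exact key x hx y hy hle
  · rw [abs_sub_comm, abs_sub_comm (e x : ℝ)]
    exact key y hy x hx hle

end FixedGapSet

/-! ### No conjugacy is Lipschitz in either direction -/

section NotLipschitz

variable {G : Type*} [Group G] {φ : G →* (unitInterval ≃ₜ unitInterval)} {N : Subgroup G}
  {h c : unitInterval ≃ₜ unitInterval} {u : ℝ → ℝ} {a b : unitInterval} {η M K : ℝ}

lemma homeomorph_pow_succ_apply (c : unitInterval ≃ₜ unitInterval) (n : ℕ) (x : unitInterval) :
    (c ^ (n + 1)) x = c ((c ^ n) x) := by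
  rw [pow_succ']
  rfl

lemma homeomorph_apply_inv_pow_succ (c : unitInterval ≃ₜ unitInterval) (n : ℕ) (x : unitInterval) :
    c ((c⁻¹ ^ (n + 1)) x) = (c⁻¹ ^ n) x := by
  rw [pow_succ']
  exact c.apply_symm_apply _

lemma preservesEnds_inv_pow {n : ℕ} (h : PreservesEnds (c⁻¹ ^ n) a b) :
    PreservesEnds (c ^ n) a b := by
  have key : ∀ {x y : unitInterval}, (c⁻¹ ^ n) x = y → (c ^ n) y = x := fun {x y} h => by
    rw [← h, inv_pow]
    exact (c ^ n).apply_symm_apply x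
  exact h.imp (fun h => ⟨key h.1, key h.2⟩) fun h => ⟨key h.2, key h.1⟩

lemma abs_ends_sub_pos (hab : IsGapOf φ a b) (e : unitInterval ≃ₜ unitInterval) :
    0 < |(e a : ℝ) - e b| :=
  abs_pos.2 (sub_ne_zero.2 fun h => hab.lt.ne (e.injective (Subtype.ext h)))

lemma abs_ends_eq (hφ : ∀ g, StrictMono (φ g))
    (hd : HasDensity h fun x => M * gapDensity (fixedGapSet φ) u a b η x)
    (hmono : StrictMono h) (hab : IsGapOf φ a b) {e : unitInterval ≃ₜ unitInterval}
    (he : CommutesWith e φ) (hne : ¬ PreservesEnds e a b) :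
    |(h (e a) : ℝ) - h (e b)| = M * u |(e a : ℝ) - e b| := by
  rw [abs_sub_eq_of_not_preservesEnds hφ hd hmono hab he hne (left_mem_Icc.2 hab.lt.le)
    (right_mem_Icc.2 hab.lt.le), mul_assoc, div_mul_cancel₀ _ (abs_ends_sub_pos hab e).ne']

/-- If no power of `c` preserves the gap, `h ∘ c` is not Lipschitz. -/
lemma not_lipschitz_of_infinite_orbit (hφ : ∀ g, StrictMono (φ g))
    (hd : HasDensity h fun x => M * gapDensity (fixedGapSet φ) u a b η x) (hM : 0 < M)
    (hmono : StrictMono h) (hu : Monotone u) (hA : ∀ K, ∃ᶠ T in 𝓝[>] 0, K * T ≤ u T)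
    (hab : IsGapOf φ a b) (hc : CommutesWith c φ)
    (horb : ∀ n : ℕ, 0 < n → ¬ PreservesEnds (c ^ n) a b) :
    ¬ ∀ x y : unitInterval, |(h (c x) : ℝ) - h (c y)| ≤ K * |(x : ℝ) - y| := by
  intro hK
  have horb' : ∀ n : ℕ, 0 < n → ¬ PreservesEnds (c⁻¹ ^ n) a b := fun n hn hp =>
    horb n hn (preservesEnds_inv_pow hp)
  -- Backward images are used so that the bound reads `u (e n) ≤ M⁻¹ K e (n + 1)`. The exponent
  -- starts at `1` because `h` is not governed by `u` on `(a, b)` itself.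
  refine not_tendsto_zero_of_mul_le hu hA (K := M⁻¹ * K)
    (e := fun n => |((c⁻¹ ^ (n + 1)) a : ℝ) - (c⁻¹ ^ (n + 1)) b|)
    (fun n => abs_ends_sub_pos hab _) (fun n => ?_)
    ((tendsto_add_atTop_iff_nat 1).2 (tendsto_dist_pow_zero hab hc.inv horb'))
  have h1 := hK ((c⁻¹ ^ (n + 1 + 1)) a) ((c⁻¹ ^ (n + 1 + 1)) b)
  rw [homeomorph_apply_inv_pow_succ, homeomorph_apply_inv_pow_succ,
    abs_ends_eq hφ hd hmono hab (hc.inv.pow _) (horb' _ n.succ_pos)] at h1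
  rw [mul_assoc, le_inv_mul_iff₀ hM]
  exact h1

/-- If no power of `c` preserves the gap, the inverse of `h ∘ c` is not Lipschitz. -/
lemma not_lipschitz_symm_of_infinite_orbit (hφ : ∀ g, StrictMono (φ g))
    (hd : HasDensity h fun x => M * gapDensity (fixedGapSet φ) u a b η x)
    (hmono : StrictMono h) (hpos : ∀ s, 0 < s → 0 < u s)
    (hB : ∀ K, ∃ᶠ T in 𝓝[>] 0, ∀ s < T, K * u s ≤ T)
    (hab : IsGapOf φ a b) (hc : CommutesWith c φ)
    (horb : ∀ n : ℕ, 0 < n → ¬ PreservesEnds (c ^ n) a b) :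
    ¬ ∀ x y : unitInterval, |(x : ℝ) - y| ≤ K * |(h (c x) : ℝ) - h (c y)| := by
  intro hK
  -- Forward images, starting with `(a, b)` itself: `u` is evaluated only at the lengths `e (n +
  -- 1)`.
  refine not_tendsto_zero_of_le_mul hB hpos (K := K * M)
    (fun n => abs_ends_sub_pos hab (c ^ n)) (fun n => ?_) (tendsto_dist_pow_zero hab hc horb)
  have h1 := hK ((c ^ n) a) ((c ^ n) b)
  rwa [← homeomorph_pow_succ_apply, ← homeomorph_pow_succ_apply,
    abs_ends_eq hφ hd hmono hab (hc.pow _) (horb _ n.succ_pos), ← mul_assoc] at h1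

/-- If `m` is the first power of `c` that preserves the gap, `h ∘ c` is not Lipschitz. -/
lemma not_lipschitz_of_finite_orbit (hφ : IsC1Action φ)
    (hd : HasDensity h fun x => M * gapDensity (fixedGapSet φ) u a b η x) (hM : 0 < M)
    (hη : 0 < η) (hmono : StrictMono h) (hpos : ∀ s, 0 < s → 0 < u s)
    (hab : IsGapOf φ a b) (hc : CommutesWith c φ)
    (hcomm : ∀ g ∈ N, ∀ k ∈ N, g * k = k * g) (hN : ∀ x ∈ Ioo a b, ∃ g ∈ N, φ g x ≠ x)
    {m : ℕ} (hm : PreservesEnds (c ^ (m + 1)) a b)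
    (hmin : ∀ j, 0 < j → j ≤ m → ¬ PreservesEnds (c ^ j) a b) :
    ¬ ∀ x y : unitInterval, |(h (c x) : ℝ) - h (c y)| ≤ K * |(x : ℝ) - y| := by
  intro hK
  have hφ' : ∀ g, StrictMono (φ g) := fun g => (hφ g).strictMono
  -- On each intermediate gap `h` is affine with slope `κ`, so the Lipschitz bound for `h ∘ c` can
  -- be iterated up to `h ∘ c ^ (m + 1)` on `[a, b]`.
  have hchain : ∀ j ≤ m, ∃ C : ℝ, ∀ x ∈ Icc a b, ∀ y ∈ Icc a b,
      |(h (c ((c ^ j) x)) : ℝ) - h (c ((c ^ j) y))| ≤ C * |(x : ℝ) - y| := by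
    intro j
    induction j with
    | zero => exact fun _ => ⟨K, fun x _ y _ => hK x y⟩
    | succ j ih =>
      intro hj
      obtain ⟨C, hC⟩ := ih (by omega)
      set κ := M * (u |((c ^ (j + 1)) a : ℝ) - (c ^ (j + 1)) b| /
          |((c ^ (j + 1)) a : ℝ) - (c ^ (j + 1)) b|) with hκ_def
      have hκ : 0 < κ :=
        mul_pos hM (div_pos (hpos _ (abs_ends_sub_pos hab _)) (abs_ends_sub_pos hab _))
      have hK0 : 0 ≤ K := by
        have := (abs_nonneg _).trans (hK 0 1)
        simpa using this
      refine ⟨K * (κ⁻¹ * C), fun x hx y hy => ?_⟩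
      have h1 := hC x hx y hy
      rw [← homeomorph_pow_succ_apply, ← homeomorph_pow_succ_apply,
        abs_sub_eq_of_not_preservesEnds hφ' hd hmono hab (hc.pow _)
          (hmin _ j.succ_pos hj) hx hy, ← hκ_def, ← le_inv_mul_iff₀ hκ] at h1
      refine (hK _ _).trans ?_
      rw [mul_assoc, mul_assoc]
      exact mul_le_mul_of_nonneg_left h1 hK0
  obtain ⟨C, hC⟩ := hchain m le_rfl
  obtain ⟨hcm, hca, hcb⟩ := apply_eq_of_preservesEnds hab (hc.pow (m + 1)) hm
  obtain ⟨L, hL, hdyn⟩ := exists_mul_sub_le_left hφ hab.left_fixed hab.right_fixed hab.lt hcomm hN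
    (hc.pow (m + 1)) hcm hca hcb
  -- The chain bounds the increment of `h` by `|C| * L` times the distance of `c ^ (m + 1) x` to
  -- `a`; a larger slope contradicts this.
  obtain ⟨y, hy, hsing⟩ := exists_le_sub_left hd hM hab.lt hη (|C| * L + 1)
  obtain ⟨x, hx, hxa, hxy, hle⟩ := hdyn y hy
  have h1 := hsing _ hxa hxy
  have h2 := hC x (Ioo_subset_Icc_self hx) a (left_mem_Icc.2 hab.lt.le)
  rw [← homeomorph_pow_succ_apply, ← homeomorph_pow_succ_apply, hca] at h2
  have h3 : (0 : ℝ) < (c ^ (m + 1)) x - a := sub_pos.2 hxa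
  have h4 : (0 : ℝ) < x - a := sub_pos.2 hx.1
  have h5 := le_abs_self ((h ((c ^ (m + 1)) x) : ℝ) - h a)
  have h6 : C * |(x : ℝ) - a| ≤ |C| * (L * ((c ^ (m + 1)) x - a)) := by
    rw [abs_of_pos h4]
    calc C * ((x : ℝ) - a) ≤ |C| * (x - a) := by gcongr; exact le_abs_self C
      _ ≤ _ := by gcongr
  nlinarith

/-- If `m` is the first power of `c` that preserves the gap, the inverse of `h ∘ c` is not
Lipschitz. -/
lemma not_lipschitz_symm_of_finite_orbit (hφ : IsC1Action φ)
    (hd : HasDensity h fun x => M * gapDensity (fixedGapSet φ) u a b η x) (hM : 0 < M)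
    (hη : 0 < η) (hmono : StrictMono h)
    (hab : IsGapOf φ a b) (hc : CommutesWith c φ)
    (hcomm : ∀ g ∈ N, ∀ k ∈ N, g * k = k * g) (hN : ∀ x ∈ Ioo a b, ∃ g ∈ N, φ g x ≠ x)
    {m : ℕ} (hm : PreservesEnds (c ^ (m + 1)) a b)
    (hmin : ∀ j, 0 < j → j ≤ m → ¬ PreservesEnds (c ^ j) a b) :
    ¬ ∀ x y : unitInterval, |(x : ℝ) - y| ≤ K * |(h (c x) : ℝ) - h (c y)| := by
  intro hK
  have hφ' : ∀ g, StrictMono (φ g) := fun g => (hφ g).strictMono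
  have hK0 : 0 < K := by
    by_contra! hle
    have h1 := hK a b
    have h2 := mul_nonpos_of_nonpos_of_nonneg hle (abs_nonneg ((h (c a) : ℝ) - h (c b)))
    exact absurd (abs_ends_sub_pos hab 1) (not_lt.2 (h1.trans h2))
  have hchain : ∀ j ≤ m, ∃ C : ℝ, ∀ x ∈ Icc a b, ∀ y ∈ Icc a b,
      |(x : ℝ) - y| ≤ C * |(h (c ((c ^ j) x)) : ℝ) - h (c ((c ^ j) y))| := by
    intro j
    induction j with
    | zero => exact fun _ => ⟨K, fun x _ y _ => hK x y⟩
    | succ j ih =>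
      intro hj
      obtain ⟨C, hC⟩ := ih (by omega)
      set κ := M * (u |((c ^ (j + 1)) a : ℝ) - (c ^ (j + 1)) b| /
          |((c ^ (j + 1)) a : ℝ) - (c ^ (j + 1)) b|) with hκ
      refine ⟨|C * κ| * K, fun x hx y hy => ?_⟩
      have h1 := hC x hx y hy
      rw [← homeomorph_pow_succ_apply, ← homeomorph_pow_succ_apply,
        abs_sub_eq_of_not_preservesEnds hφ' hd hmono hab (hc.pow _)
          (hmin _ j.succ_pos hj) hx hy, ← hκ, ← mul_assoc] at h1
      refine h1.trans ?_
      rw [mul_assoc |C * κ|]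
      exact mul_le_mul (le_abs_self _) (hK _ _) (abs_nonneg _) (abs_nonneg _)
  obtain ⟨C, hC⟩ := hchain m le_rfl
  obtain ⟨hcm, hca, hcb⟩ := apply_eq_of_preservesEnds hab (hc.pow (m + 1)) hm
  obtain ⟨L, hL, hdyn⟩ := exists_mul_sub_le_right hφ hab.left_fixed hab.right_fixed hab.lt hcomm hN
    (hc.pow (m + 1)) hcm hca hcb
  -- With this slope, `b - x` would be at most `|C| * L / (|C| * L + 1)` times itself.
  obtain ⟨y, hy, hsing⟩ := exists_sub_le_right hd hM hab.lt hη
    (B := (|C| * L + 1)⁻¹) (by positivity)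
  obtain ⟨x, hx, hxy, hxb, hle⟩ := hdyn y hy
  have h1 := hsing _ hxy hxb
  have h2 := hC b (right_mem_Icc.2 hab.lt.le) x (Ioo_subset_Icc_self hx)
  rw [← homeomorph_pow_succ_apply, ← homeomorph_pow_succ_apply, hcb] at h2
  have h3 : (0 : ℝ) < b - x := sub_pos.2 hx.2
  have h4 : (h ((c ^ (m + 1)) x) : ℝ) ≤ h b := hmono.monotone hxb.le
  rw [abs_of_pos h3, abs_of_nonneg (sub_nonneg.2 h4)] at h2
  rw [le_inv_mul_iff₀ (by positivity)] at h1
  have h5 : (b : ℝ) - x ≤ |C| * (h b - h ((c ^ (m + 1)) x)) :=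
    h2.trans (mul_le_mul_of_nonneg_right (le_abs_self C) (sub_nonneg.2 h4))
  have h6 : (0 : ℝ) < h b - h ((c ^ (m + 1)) x) := by
    by_contra! hle
    have := mul_nonpos_of_nonneg_of_nonpos (abs_nonneg C) hle
    linarith
  have h7 : L * ((b : ℝ) - x) ≤ L * (|C| * (h b - h ((c ^ (m + 1)) x))) := by gcongr
  nlinarith

theorem not_lipschitz_comp (hφ : IsC1Action φ)
    (hd : HasDensity h fun x => M * gapDensity (fixedGapSet φ) u a b η x) (hM : 0 < M)
    (hη : 0 < η) (hmono : StrictMono h) (hu : Monotone u) (hpos : ∀ s, 0 < s → 0 < u s)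
    (hA : ∀ K, ∃ᶠ T in 𝓝[>] 0, K * T ≤ u T)
    (hB : ∀ K, ∃ᶠ T in 𝓝[>] 0, ∀ s < T, K * u s ≤ T)
    (hab : IsGapOf φ a b) (hcomm : ∀ g ∈ N, ∀ k ∈ N, g * k = k * g)
    (hN : ∀ x ∈ Ioo a b, ∃ g ∈ N, φ g x ≠ x) (hc : CommutesWith c φ) (K : ℝ) :
    (¬ ∀ x y : unitInterval, |(h (c x) : ℝ) - h (c y)| ≤ K * |(x : ℝ) - y|) ∧
      ¬ ∀ x y : unitInterval, |(x : ℝ) - y| ≤ K * |(h (c x) : ℝ) - h (c y)| := by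
  classical
  have hφ' : ∀ g, StrictMono (φ g) := fun g => (hφ g).strictMono
  by_cases horb : ∀ n : ℕ, 0 < n → ¬ PreservesEnds (c ^ n) a b
  · exact ⟨not_lipschitz_of_infinite_orbit hφ' hd hM hmono hu hA hab hc horb,
      not_lipschitz_symm_of_infinite_orbit hφ' hd hmono hpos hB hab hc horb⟩
  · have hex : ∃ m : ℕ, PreservesEnds (c ^ (m + 1)) a b := by
      push Not at horb
      obtain ⟨n, hn, hn'⟩ := horb
      exact ⟨n - 1, by rwa [Nat.sub_add_cancel hn]⟩
    have hmin : ∀ j, 0 < j → j ≤ Nat.find hex → ¬ PreservesEnds (c ^ j) a b := fun j hj hjm hp =>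
      Nat.find_min hex (m := j - 1) (by omega) (by rwa [Nat.sub_add_cancel hj])
    exact ⟨not_lipschitz_of_finite_orbit hφ hd hM hη hmono hpos hab hc hcomm hN
        (Nat.find_spec hex) hmin,
      not_lipschitz_symm_of_finite_orbit hφ hd hM hη hmono hab hc hcomm hN
        (Nat.find_spec hex) hmin⟩

end NotLipschitz

/-! ### The perturbation and the theorem -/

/-- The subgroup of the elements that fix the point `x`. -/
def fixator {G : Type*} [Group G] (φ : G →* (unitInterval ≃ₜ unitInterval)) (x : unitInterval) :
    Subgroup G where
  carrier := {g | φ g x = x}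
  mul_mem' {g k} (hg : φ g x = x) (hk : φ k x = x) := by
    show φ (g * k) x = x
    rw [action_mul_apply, hk, hg]
  one_mem' := by
    show φ 1 x = x
    rw [map_one]
    rfl
  inv_mem' {g} (hg : φ g x = x) := by
    show φ g⁻¹ x = x
    conv_lhs => rw [← hg]
    exact action_inv_apply φ g x

/-- The group enters only through a nontrivially acting element, a commutative normal subgroup `N`,
and an element `t` that together with `N` detects global fixed points. -/
theorem exists_perturbation {G : Type*} [Group G] {φ : G →* (unitInterval ≃ₜ unitInterval)}
    (hφ : IsC1Action φ) {g₀ : G} (hg₀ : φ g₀ ≠ 1) {N : Subgroup G} [N.Normal]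
    (hcomm : ∀ g ∈ N, ∀ k ∈ N, g * k = k * g) {t : G}
    (hgen : ∀ x, (∀ g ∈ N, φ g x = x) → φ t x = x → ∀ g, φ g x = x)
    (F : Finset G) {ε : ℝ} (hε : 0 < ε) :
    ∃ ψ : G →* (unitInterval ≃ₜ unitInterval),
      IsC1Action ψ ∧
      (∀ g ∈ F, C1Close ε (φ g) (ψ g)) ∧
      (∃ h : unitInterval ≃ₜ unitInterval, StrictMono h ∧ Conjugates h φ ψ) ∧
      (∀ h : unitInterval ≃ₜ unitInterval, Conjugates h φ ψ →
        ¬ IsLipschitz h ∧ ¬ IsLipschitz h.symm) := by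
  have hφ' : ∀ g, StrictMono (φ g) := fun g => (hφ g).strictMono
  obtain ⟨x, hx⟩ : ∃ x, φ g₀ x ≠ x := by
    by_contra! hall
    exact hg₀ (Homeomorph.ext hall)
  obtain ⟨a, b, hab⟩ := exists_isGapOf hφ' hx
  obtain ⟨N', hcomm', hN'⟩ := exists_commutative_subgroup hφ' hcomm hgen hab.not_fixed
  have hP := isGapSet_fixedGapSet φ
  have hfix : ∀ g, ∀ x : unitInterval, (x : ℝ) ∈ fixedGapSet φ → φ g x = x := fun g x hx =>
    (coe_mem_fixedGapSet hφ').1 hx g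
  choose δ hδ hclose using fun g => exists_c1Close_conj hP hab.lt (hφ g) (hfix g)
    (hab.left_fixed g) (hab.right_fixed g) hε
  -- With `η` as the integral bound for the slopes, the density is within `3 η` of `1` in the mean,
  -- so `h` is within `6 η` of the identity.
  have hev : ∀ᶠ η in 𝓝[>] (0 : ℝ), ∀ g ∈ F, 6 * η < δ g := by
    refine (Filter.eventually_all_finset F).2 fun g _ => eventually_nhdsWithin_of_eventually_nhds ?_
    have : Tendsto (fun η : ℝ => 6 * η) (𝓝 0) (𝓝 (6 * 0)) := tendsto_id.const_mul 6
    rw [mul_zero] at this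
    exact this.eventually (gt_mem_nhds (hδ g))
  obtain ⟨η, hηF, hη⟩ := (hev.and self_mem_nhdsWithin).exists
  have hη0 : 0 < η := hη
  obtain ⟨u, hu, hpos, hint, hA, hB⟩ := exists_oscillating_length (volume.restrict (Icc 0 1))
    hP.measurable_gapLength hP.gapLength_nonneg hη0
  have hint' := lintegral_gapDensity_sub_one_le hP hu.measurable a.2.1 hab.lt b.2.2 hη0.le hη0.le
    hint
  have hρpos := gapDensity_pos (a := a) (b := b) hP hpos a.2.1 b.2.2 hη0.le
  have hρint := integrableOn_gapDensity hP hu.measurable hint'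
  obtain ⟨h, hmono, hd⟩ := exists_hasDensity hρpos hρint
  have hM := inv_pos.2 (integral_pos_of_lt hρpos hρint (x := 0) (y := 1) (by simp) (by simp)
    one_pos)
  have hhclose := abs_density_sub_le hρpos hρint hmono hd (by positivity) hint'
  refine ⟨(MulAut.conj h).toMonoidHom.comp φ, fun g => ?_, fun g hg => ?_,
    ⟨h, hmono, fun g x => ?_⟩, fun k hk => ?_⟩
  · exact isC1Diffeo_conj hP hpos hab.lt hη0 hmono hd (hφ g) (by rw [← map_inv]; exact hφ g⁻¹)
      (hfix g) (hab.left_fixed g) (hab.right_fixed g)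
  · have := hηF g hg
    exact hclose g u η _ h hpos hη0 (by linarith) hmono hd fun x =>
      (hhclose x).trans (by linarith)
  · exact (congrArg (fun w => h (φ g w)) (h.symm_apply_apply x)).symm
  -- Any conjugacy `k` differs from `h` by an element of the centralizer of `φ`: `k = h ∘ c` with `c
  -- = h⁻¹ * k`.
  · have hc : CommutesWith (h⁻¹ * k) φ := fun g x => by
      show h.symm (k (φ g x)) = φ g (h.symm (k x))
      rw [Homeomorph.symm_apply_eq]
      exact hk g x
    have hkc : ∀ x, h ((h⁻¹ * k) x) = k x := fun x => h.apply_symm_apply (k x)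
    have main := not_lipschitz_comp hφ hd hM hη0 hmono hu hpos hA hB hab hcomm' hN' hc
    simp only [hkc] at main
    constructor
    · rintro ⟨K, hK⟩
      exact (main K).1 fun x y => hK.dist_le_mul x y
    · rintro ⟨K, hK⟩
      refine (main K).2 fun x y => ?_
      have := hK.dist_le_mul (k x) (k y)
      rwa [k.symm_apply_apply, k.symm_apply_apply] at this

theorem mainTheorem10 (d : ℕ) (A : GL (Fin d) ℚ) (H : AddSubgroup (Fin d → ℚ))
    (hH : ∀ v, (A : Matrix (Fin d) (Fin d) ℚ) *ᵥ v ∈ H ↔ v ∈ H)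
    (hrank : Module.finrank ℚ (Submodule.span ℚ (H : Set (Fin d → ℚ))) = d)
    (φ : MatrixSemidirect A H hH →* (unitInterval ≃ₜ unitInterval))
    (hφ : IsC1Action φ) (hfaithful : Function.Injective φ)
    (F : Finset (MatrixSemidirect A H hH)) (ε : ℝ) (hε : 0 < ε) :
    ∃ ψ : MatrixSemidirect A H hH →* (unitInterval ≃ₜ unitInterval),
      IsC1Action ψ ∧
      (∀ g ∈ F, C1Close ε (φ g) (ψ g)) ∧
      (∃ h : unitInterval ≃ₜ unitInterval, StrictMono h ∧ Conjugates h φ ψ) ∧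
      (∀ h : unitInterval ≃ₜ unitInterval, Conjugates h φ ψ →
        ¬ IsLipschitz h ∧ ¬ IsLipschitz h.symm) := by
  let t : MatrixSemidirect A H hH := SemidirectProduct.inr (Multiplicative.ofAdd 1)
  let N : Subgroup (MatrixSemidirect A H hH) := SemidirectProduct.inl.range
  have hNormal : N.Normal := by
    show (SemidirectProduct.inl.range : Subgroup (MatrixSemidirect A H hH)).Normal
    rw [SemidirectProduct.range_inl_eq_ker_rightHom]
    infer_instance
  -- Faithfulness provides a nontrivially acting element, hence a gap.
  have ht : φ t ≠ 1 := fun h => by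
    have h1 : t = 1 := hfaithful (h.trans (map_one φ).symm)
    have h2 := congrArg SemidirectProduct.right h1
    exact one_ne_zero (congrArg Multiplicative.toAdd h2 : (1 : ℤ) = 0)
  refine exists_perturbation hφ ht (N := N) (t := t) ?_ (fun x hx hxt g => ?_) F hε
  · rintro _ ⟨v, rfl⟩ _ ⟨w, rfl⟩
    rw [← map_mul, ← map_mul, mul_comm]
  -- Every element is the product of an element of `N` and a power of `t`, so a common fixed point
  -- of `N` and `t` is global.
  · have hright : SemidirectProduct.inr g.right = t ^ (Multiplicative.toAdd g.right) := by
      rw [← map_zpow, ← ofAdd_zsmul, zsmul_one]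
      rfl
    have hstab : ∀ z : ℤ, φ (t ^ z) x = x := fun z => by
      have : t ∈ fixator φ x := hxt
      exact zpow_mem this z
    rw [← SemidirectProduct.inl_left_mul_inr_right g, action_mul_apply, hright, hstab]
    exact hx _ ⟨_, rfl⟩
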